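/- Let $I=[0,1]$, and let $C(I)$ be the set of continuous surjective maps $f\colon I\to I$ with the uniform metric $\rho(f,g)=\sup_{x\in I}|f(x)-g(x)|$. Let $CP\subset C(I)$ be the set of maps whose periodic points are dense in $I$. For a non-atomic Borel probability measure $\mu$ on $I$ with full support, let $C_\mu\subset C(I)$ be the set of maps preserving $\mu$, and let $C_\lambda$ be the set of maps in $C(I)$ preserving Lebesgue measure $\lambda$. A map $f\in C(I)$ is *leo* (locally eventually onto, topologically exact) if for every nonempty open set $U\subset I$ there is $n\in\mathbb N$ with $f^n(U)=I$. It has the *periodic specification property* if for every $\varepsilon>0$ there is an integer $N\ge 1$ such that for all $p\ge 1$, all $x_1,\dots,x_p\in I$, all integers $0\le a_1\le b_1<a_2\le b_2<\dots<a_p\le b_p$ with $a_{i+1}-b_i\ge N$ for $1\le i<p$, and every integer $q\ge N+b_p-a_1$, there is $y\in I$ with $f^q(y)=y$ and $|f^n(y)-f^n(x_i)|\le\varepsilon$ for all $1\le i\le p$ and $a_i\le n\le b_i$. **Theorem 5.3.** Let $X$ be one of the spaces $CP$, $C_\lambda$, or $C_\mu$ with $\mu$ any non-atomic Borel probability measure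 on $I$ with full support, equipped with the metric $\rho$. Then leo maps form an open dense collection in $X$, in the following sense: the set $$\{f\in X:\ f \text{ is leo and } f(\{0,1\})\cap\{0,1\}=\emptyset\}$$ is open in $X$ and dense in $X$. Moreover, every leo map in $X$ has the periodic specification property. In particular, the set of maps in $X$ with the periodic specification property contains an open dense subset of $X$. -/

import Mathlib

/-! Interval maps are elements of `C(unitInterval, unitInterval)`, whose distance is the uniform
metric `ρ(f, g) = sup |f x - g x|`. -/

namespace IntervalMaps

/-- Surjective continuous self-maps of `I = [0,1]`. -/
def CI : Set C(unitInterval, unitInterval) :=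
  {f | Function.Surjective f}

/-- Maps with a dense set of periodic points. -/
def CP : Set C(unitInterval, unitInterval) :=
  {f | f ∈ CI ∧ Dense (Function.periodicPts f)}

/-- Maps preserving the measure `μ`. -/
def Cmeas (μ : MeasureTheory.Measure unitInterval) : Set C(unitInterval, unitInterval) :=
  {f | f ∈ CI ∧ MeasureTheory.MeasurePreserving f μ μ}

/-- Maps preserving Lebesgue measure on `[0,1]`. -/
noncomputable def Clambda : Set C(unitInterval, unitInterval) :=
  Cmeas MeasureTheory.volume

/-- Locally eventually onto (topologically exact) maps. -/
def IsLeo (f : C(unitInterval, unitInterval)) : Prop :=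
  ∀ U : Set unitInterval, IsOpen U → U.Nonempty → ∃ n : ℕ, f^[n] '' U = Set.univ

/-- No endpoint of `[0,1]` is mapped to an endpoint: `f({0,1}) ∩ {0,1} = ∅`. -/
def MovesEndpointsInside (f : C(unitInterval, unitInterval)) : Prop :=
  (f '' {0, 1}) ∩ {0, 1} = ∅

/-- The periodic specification property: for each `ε > 0` there is a gap length `N ≥ 1` such that
any finite family of at least one orbit segment, the `i`-th being taken over the times
`a i, …, b i`, with consecutive gaps `a (i+1) - b i ≥ N`, is `ε`-traced by a point `y` with
`f^q y = y`, for every `q ≥ N + (b_last - a_first)`. -/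
def PeriodicSpecification (f : C(unitInterval, unitInterval)) : Prop :=
  ∀ ε : ℝ, 0 < ε → ∃ N : ℕ, 1 ≤ N ∧
    ∀ (p : ℕ) (x : Fin (p + 1) → unitInterval) (a b : Fin (p + 1) → ℕ),
      (∀ i, a i ≤ b i) →
      (∀ i : Fin p, b i.castSucc + N ≤ a i.succ) →
      ∀ q : ℕ, N + b (Fin.last p) ≤ q + a 0 →
        ∃ y : unitInterval, f^[q] y = y ∧
          ∀ i, ∀ n : ℕ, a i ≤ n → n ≤ b i → dist (f^[n] y) (f^[n] (x i)) ≤ ε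

/-- The set of leo maps with `f({0,1}) ∩ {0,1} = ∅` lying in `X` is open and dense in `X`
(for the uniform metric on `X`), and every leo map in `X`
has the periodic specification property. -/
def LeoOpenDenseWithSpecification (X : Set C(unitInterval, unitInterval)) : Prop :=
  IsOpen {f : X | IsLeo f.1 ∧ MovesEndpointsInside f.1} ∧
  Dense {f : X | IsLeo f.1 ∧ MovesEndpointsInside f.1} ∧
  ∀ f ∈ X, IsLeo f → PeriodicSpecification f

end IntervalMaps

/-!
A map with dense periodic points (`CP`) collapses no interval, and points outside a forward
invariant interval cannot enter its interior. If an open set contains periodic points `p < q`, both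
fixed by an iterate `h`, the intervals `h^k [p, q]` increase to an `h`-invariant interval `L`.
Either `L` contains `(0,1)`, and then some `h^k [p, q]` contains preimages of both endpoints if the
endpoints are moved inside, so its image is `[0,1]`; or an endpoint `c ∈ (0,1)` of the closure of
`L` splits `[0,1]` into two intervals invariant under some iterate. So in `CP` a map that moves the
endpoints inside is leo unless it has such a separating point
(`isLeo_of_forall_not_separates`). By Poincaré recurrence, a map preserving a finite measure of
full support is in `CP` (`cmeas_subset_CP`), so this criterion applies to all the spaces.

*Openness* (`eventually_isLeo`). Some iterate of a leo map sends both halves of `[0,1]` onto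
`[0,1]`. If the endpoints are moved inside, this survives small perturbations, at the cost of one
more iterate, and it excludes separating points.

*Density for measure-preserving maps.* A point `c` does not separate if the images of `[0,c]` and
`[c,1]` share an interval. After composition with a measure-preserving map `φ` near the identity
that makes the two sides of every point of `(0,1)` overlap, this holds for every `c`
(`Overlaps.comp_right`); one more composition moves the endpoints inside. For Lebesgue measure, `φ`
is a composition of two zigzag maps over grids without common interior points
(`hasPerturbations_volume`); other measures are reduced to this one by their distribution
function (`exists_orderIso_measurePreserving`).

*Density in `CP`* (`exists_leo_near`). Add a steep oscillation to a Lipschitz approximation of `f`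
and fold the result into `[0,1]`. The new map is expanding, so intervals grow to contain a block of
the oscillation; and a block is mapped over a neighbourhood of its `f`-image. Following periodic
orbits of `f`, an iterate maps each block over itself and its neighbours, so a further one maps it
onto `[0,1]`.

*Specification* (`IsLeo.periodicSpecification`). Intervals of length at least `ε` never become
shorter than some `δ(ε)` and intervals of length `δ` cover `[0,1]` after a common time. So each
orbit segment is followed by an interval whose final image has length at least `δ`, and after the
gap its image covers the interval chosen for the next segment. The chain closes up, and yields a
periodic point.
-/

namespace IntervalMaps

open Set Function Topology unitInterval MeasureTheory

/-! ### Images of intervals, and the specification property of leo maps -/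

theorem ordConnected_image {h : I → I} (hh : Continuous h) {S : Set I} (hS : S.OrdConnected) :
    (h '' S).OrdConnected :=
  (hS.isPreconnected.image h hh.continuousOn).ordConnected

theorem eq_univ_of_zero_mem_of_one_mem {S : Set I} (hS : S.OrdConnected) (h0 : 0 ∈ S)
    (h1 : 1 ∈ S) : S = univ :=
  eq_univ_of_forall fun x => hS.out h0 h1 ⟨x.2.1, x.2.2⟩

theorem dist_lt_of_mem_uIcc {s t w : I} (hw : w ∈ uIcc s t) (hne : w ≠ t) :
    dist s w < dist s t := by
  have hne' : (w : ℝ) ≠ t := fun h => hne (Subtype.ext h)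
  rw [Subtype.dist_eq, Subtype.dist_eq, Real.dist_eq, Real.dist_eq]
  rcases mem_uIcc.1 hw with ⟨h1, h2⟩ | ⟨h1, h2⟩
  · have h1' : (s : ℝ) ≤ w := h1
    have h2' : (w : ℝ) < t := lt_of_le_of_ne h2 hne'
    rw [abs_of_nonpos (by linarith), abs_of_nonpos (by linarith)]
    linarith
  · have h1' : (t : ℝ) < w := lt_of_le_of_ne h1 hne'.symm
    have h2' : (w : ℝ) ≤ s := h2
    rw [abs_of_nonneg (by linarith), abs_of_nonneg (by linarith)]
    linarith

/-- An interval that covers `[α, β]` under `h` contains an interval that is mapped exactly onto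
`[α, β]`. -/
theorem exists_uIcc_image_eq {h : I → I} (hh : Continuous h) {u v α β : I} (hαβ : α ≤ β)
    (hcov : Icc α β ⊆ h '' uIcc u v) :
    ∃ s ∈ uIcc u v, ∃ t ∈ uIcc u v, h '' uIcc s t = Icc α β := by
  let P : Set (I × I) :=
    ((uIcc u v) ×ˢ (uIcc u v)) ∩ {z | h z.1 = α ∧ h z.2 = β}
  have hP : IsCompact P := by
    refine (isCompact_uIcc.prod isCompact_uIcc).inter_right ?_
    exact (isClosed_eq (hh.comp continuous_fst) continuous_const).inter
      (isClosed_eq (hh.comp continuous_snd) continuous_const)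
  obtain ⟨x, hx, hxα⟩ := hcov (left_mem_Icc.2 hαβ)
  obtain ⟨y, hy, hyβ⟩ := hcov (right_mem_Icc.2 hαβ)
  -- Among the pairs that `h` maps to `(α, β)`, a closest one spans an interval that does the job.
  obtain ⟨⟨s, t⟩, ⟨⟨hs, ht⟩, hsα, htβ⟩, hmin⟩ :=
    hP.exists_isMinOn ⟨(x, y), ⟨hx, hy⟩, hxα, hyβ⟩
      (f := fun z : I × I => dist z.1 z.2) (by fun_prop)
  simp only at hs ht hsα htβ
  have hsub : uIcc s t ⊆ uIcc u v := uIcc_subset_uIcc hs ht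
  refine ⟨s, hs, t, ht, Subset.antisymm ?_ ?_⟩
  · rintro _ ⟨w, hw, rfl⟩
    by_contra hcon
    rw [mem_Icc, not_and_or, not_le, not_le] at hcon
    rcases hcon with hcon | hcon
    · -- the value `α` is taken again between `w` and `t`
      have hα : α ∈ h '' uIcc w t := by
        refine intermediate_value_uIcc hh.continuousOn (mem_uIcc.2 (Or.inl ⟨hcon.le, ?_⟩))
        rw [htβ]; exact hαβ
      obtain ⟨w', hw', hw'α⟩ := hα
      have hw't : w' ∈ uIcc s t := uIcc_subset_uIcc hw right_mem_uIcc hw'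
      have hne : w' ≠ s := by
        rintro rfl
        have h1 : w ∈ uIcc t w' := by rwa [uIcc_comm]
        have h2 : w' ∈ uIcc t w := by rwa [uIcc_comm]
        have : w ≠ w' := by rintro rfl; exact absurd hw'α hcon.ne
        have h3 := dist_lt_of_mem_uIcc h1 this
        have h4 := dist_lt_of_mem_uIcc h2 this.symm
        exact lt_asymm h3 h4
      have hlt := dist_lt_of_mem_uIcc (by rwa [uIcc_comm] at hw't) hne
      have hge := hmin (show (w', t) ∈ P from ⟨⟨hsub hw't, ht⟩, hw'α, htβ⟩)
      simp only [mem_ofPred_eq] at hge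
      rw [dist_comm s t, dist_comm w' t] at hge
      exact absurd hge (not_le.2 hlt)
    · have hβ : β ∈ h '' uIcc s w := by
        refine intermediate_value_uIcc hh.continuousOn (mem_uIcc.2 (Or.inl ⟨?_, hcon.le⟩))
        rw [hsα]; exact hαβ
      obtain ⟨w', hw', hw'β⟩ := hβ
      have hw't : w' ∈ uIcc s t := uIcc_subset_uIcc left_mem_uIcc hw hw'
      have hne : w' ≠ t := by
        rintro rfl
        have : w ≠ w' := by rintro rfl; exact absurd hw'β hcon.ne'
        exact lt_asymm (dist_lt_of_mem_uIcc hw this) (dist_lt_of_mem_uIcc hw' this.symm)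
      have hlt := dist_lt_of_mem_uIcc hw't hne
      have hge := hmin (show (s, w') ∈ P from ⟨⟨hs, hsub hw't⟩, hsα, hw'β⟩)
      simp only [mem_ofPred_eq] at hge
      exact absurd hge (not_le.2 hlt)
  · have := intermediate_value_uIcc (f := h) (a := s) (b := t) hh.continuousOn
    rwa [hsα, htβ, uIcc_of_le hαβ] at this

/-- A continuous map under which an interval covers itself has a fixed point in it. -/
theorem exists_fixedPt_of_subset_image {h : I → I} (hh : Continuous h) {S : Set I}
    (hS : S.OrdConnected) {u v : I} (hu : u ∈ S) (hv : v ∈ S) (hSuv : S ⊆ Icc u v)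
    (hcov : S ⊆ h '' S) : ∃ z ∈ S, h z = z := by
  obtain ⟨x, hx, hxu⟩ := hcov hu
  obtain ⟨y, hy, hyv⟩ := hcov hv
  obtain ⟨c, hc, hfix⟩ := exists_mem_uIcc_isFixedPt (f := h) (a := y) (b := x) hh.continuousOn
    (by rw [hyv]; exact (hSuv hy).2) (by rw [hxu]; exact (hSuv hx).1)
  exact ⟨c, hS.uIcc_subset hy hx hc, hfix⟩

theorem exists_Icc_subset {U : Set I} (hU : IsOpen U) (hne : U.Nonempty) :
    ∃ b c, b < c ∧ Icc b c ⊆ U := by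
  obtain ⟨x, hx⟩ := hne
  obtain ⟨b, c, -, hnhds, hsub⟩ := exists_Icc_mem_subset_of_mem_nhds (hU.mem_nhds hx)
  refine ⟨b, c, ?_, hsub⟩
  by_contra hcb
  -- otherwise `[b, c]` has at most one point, and `x` would be isolated
  have hss : Icc b c ⊆ {x} := fun y hy => by
    have hx' := mem_of_mem_nhds hnhds
    have hbc := not_lt.1 hcb
    exact le_antisymm (hy.2.trans (hbc.trans hx'.1)) (hx'.2.trans (hbc.trans hy.1))
  have hopen : IsOpen ({x} : Set I) := by
    rw [isOpen_singleton_iff_nhds_eq_pure]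
    exact le_antisymm (Filter.le_pure_iff.2 (Filter.mem_of_superset hnhds hss)) (pure_le_nhds x)
  have := IsClopen.eq_univ ⟨isClosed_singleton, hopen⟩ ⟨x, rfl⟩
  have h0 : (0 : I) ∈ ({x} : Set I) := this ▸ mem_univ _
  have h1 : (1 : I) ∈ ({x} : Set I) := this ▸ mem_univ _
  rw [mem_singleton_iff] at h0 h1
  exact zero_ne_one (h0.trans h1.symm)

theorem image_iterate_eq_univ_of_le {f : I → I} (hf : Surjective f) {S : Set I} {m n : ℕ}
    (hmn : m ≤ n) (h : f^[m] '' S = univ) : f^[n] '' S = univ := by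
  obtain ⟨k, rfl⟩ := Nat.exists_eq_add_of_le' hmn
  rw [iterate_add, image_comp, h, image_univ]
  exact (hf.iterate k).range_eq

/-- A leo map sends all intervals of length at least `δ` onto `[0,1]` at a common time. -/
theorem IsLeo.exists_covering_time {f : C(I, I)} (hf : IsLeo f) (hs : Surjective f) {δ : ℝ}
    (hδ : 0 < δ) :
    ∃ N : ℕ, ∀ S : Set I, S.OrdConnected → ∀ x ∈ S, ∀ y ∈ S, δ ≤ dist x y →
      ∀ m, N ≤ m → f^[m] '' S = univ := by
  have hball : ∀ t : I, ∃ n : ℕ, f^[n] '' Metric.ball t (δ / 4) = univ := fun t =>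
    hf _ Metric.isOpen_ball ⟨t, Metric.mem_ball_self (by positivity)⟩
  choose n hn using hball
  obtain ⟨T, hT⟩ := (isCompact_univ (X := I)).elim_finite_subcover
    (fun t : I => Metric.ball t (δ / 4)) (fun _ => Metric.isOpen_ball)
    (fun t _ => mem_iUnion.2 ⟨t, Metric.mem_ball_self (by positivity)⟩)
  refine ⟨T.sup n, ?_⟩
  have key : ∀ S : Set I, S.OrdConnected → ∀ x ∈ S, ∀ y ∈ S, x ≤ y → δ ≤ dist x y →
      ∀ m, T.sup n ≤ m → f^[m] '' S = univ := by
    intro S hS x hx y hy hxy hd m hm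
    have hxy' : (x : ℝ) ≤ y := hxy
    have hd' : δ ≤ y - x := by
      rw [Subtype.dist_eq, Real.dist_eq, abs_of_nonpos (by linarith)] at hd; linarith
    let z : I := ⟨(x + y) / 2, by constructor <;> linarith [x.2.1, x.2.2, y.2.1, y.2.2]⟩
    obtain ⟨t, ht, hzt⟩ := mem_iUnion₂.1 (hT (mem_univ z))
    have hsub : Metric.ball t (δ / 4) ⊆ S := by
      intro w hw
      have h1 : |((x : ℝ) + y) / 2 - t| < δ / 4 := hzt
      have h2 : |(w : ℝ) - t| < δ / 4 := hw
      rw [abs_lt] at h1 h2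
      refine hS.out hx hy ⟨?_, ?_⟩
      · change (x : ℝ) ≤ w; linarith
      · change (w : ℝ) ≤ y; linarith
    refine image_iterate_eq_univ_of_le hs ((Finset.le_sup ht).trans hm) (eq_univ_of_univ_subset ?_)
    rw [← hn t]
    exact image_mono hsub
  intro S hS x hx y hy hd m hm
  rcases le_total x y with h | h
  · exact key S hS x hx y hy h hd m hm
  · exact key S hS y hy x hx h (by rwa [dist_comm]) m hm

/-- Under the iterates of a leo map, the images of an interval of length at least `ε` never become
shorter than some `δ > 0`. -/
theorem IsLeo.exists_length_bound {f : C(I, I)} (hf : IsLeo f) (hs : Surjective f) {ε : ℝ}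
    (hε : 0 < ε) :
    ∃ δ : ℝ, 0 < δ ∧ ∀ S : Set I, S.OrdConnected → ∀ x ∈ S, ∀ y ∈ S, ε ≤ dist x y →
      ∀ j, ∃ u ∈ S, ∃ v ∈ S, δ ≤ dist (f^[j] u) (f^[j] v) := by
  obtain ⟨N, hN⟩ := hf.exists_covering_time hs hε
  have huc : ∀ i : ℕ, ∃ δ > 0, ∀ a b : I, dist a b < δ → dist (f^[i] a) (f^[i] b) < 1 := fun i => by
    have := CompactSpace.uniformContinuous_of_continuous (f.continuous.iterate i)
    obtain ⟨δ, hδ, h⟩ := Metric.uniformContinuous_iff.1 this 1 one_pos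
    exact ⟨δ, hδ, fun a b hab => h hab⟩
  choose d hd0 hd using huc
  obtain ⟨δ, hδ0, hδ⟩ : ∃ δ > 0, ∀ i ∈ Finset.range (N + 1), δ ≤ d i := by
    refine ⟨(Finset.range (N + 1)).inf' Finset.nonempty_range_add_one d, ?_,
      fun i hi => Finset.inf'_le _ hi⟩
    exact (Finset.lt_inf'_iff _).2 fun i _ => hd0 i
  refine ⟨δ, hδ0, fun S hS x hx y hy hxy j => ?_⟩
  -- at time `max N j` the two points are `0` and `1`, and there are at most `N` steps from `j` on
  have hcov := hN S hS x hx y hy hxy (max N j) (le_max_left _ _)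
  obtain ⟨u, hu, hu0⟩ := hcov.symm ▸ mem_univ (0 : I)
  obtain ⟨v, hv, hv1⟩ := hcov.symm ▸ mem_univ (1 : I)
  refine ⟨u, hu, v, hv, (hδ (max N j - j) (by simp)).trans ?_⟩
  by_contra hlt
  have := hd _ _ _ (not_le.1 hlt)
  rw [← iterate_add_apply, ← iterate_add_apply, Nat.sub_add_cancel (le_max_right _ _), hu0, hv1,
    Subtype.dist_eq, Real.dist_eq] at this
  norm_num at this

/-- Every point of a leo map has, for each time `n`, an interval of points that follow it up to
error `ε` until time `n`, whose image at time `n` is not shorter than a `δ` that depends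
on `ε` only. -/
theorem IsLeo.exists_shadowing_interval {f : C(I, I)} (hf : IsLeo f) (hs : Surjective f) {ε : ℝ}
    (hε : 0 < ε) :
    ∃ δ : ℝ, 0 < δ ∧ ∀ (x : I) (n : ℕ), ∃ u v : I,
      (∀ y ∈ uIcc u v, ∀ i ≤ n, dist (f^[i] y) (f^[i] x) ≤ ε) ∧
      ∃ s ∈ uIcc u v, ∃ t ∈ uIcc u v, δ ≤ dist (f^[n] s) (f^[n] t) := by
  obtain ⟨δ, hδ0, hδ⟩ := hf.exists_length_bound hs hε
  refine ⟨min δ 1, by positivity, fun x n => ?_⟩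
  let E : Set I := ⋃ i ∈ Finset.range (n + 1), {y | ε ≤ dist (f^[i] y) (f^[i] x)}
  have hmemE : ∀ y, y ∈ E ↔ ∃ i ≤ n, ε ≤ dist (f^[i] y) (f^[i] x) := fun y => by
    simp [E]
  have hcont : ∀ i, Continuous fun y => dist (f^[i] y) (f^[i] x) := fun i =>
    (f.continuous.iterate i).dist continuous_const
  have hE : IsClosed E :=
    (Finset.range (n + 1)).finite_toSet.isClosed_biUnion fun i _ =>
      isClosed_le continuous_const (hcont i)
  rcases E.eq_empty_or_nonempty with hemp | hne
  · refine ⟨0, 1, fun y _ i hi => ?_, ?_⟩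
    · by_contra hlt
      have : y ∈ E := (hmemE y).2 ⟨i, hi, (not_le.1 hlt).le⟩
      rw [hemp] at this
      exact this
    · obtain ⟨s, hs0⟩ := (hs.iterate n) 0
      obtain ⟨t, ht1⟩ := (hs.iterate n) 1
      have huniv : ∀ w : I, w ∈ uIcc (0 : I) 1 := fun w =>
        mem_uIcc.2 (Or.inl ⟨w.2.1, w.2.2⟩)
      refine ⟨s, huniv s, t, huniv t, ?_⟩
      rw [hs0, ht1, Subtype.dist_eq, Real.dist_eq]
      norm_num
  · -- go from `x` to the nearest point `c` at which some iterate reaches the distance `ε`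
    obtain ⟨c, hcE, hmin⟩ := hE.isCompact.exists_isMinOn hne
      (f := fun y => dist x y) (by fun_prop)
    have hlt : ∀ y ∈ uIcc x c, y ≠ c → y ∉ E := fun y hy hyc hyE =>
      absurd (hmin hyE) (not_le.2 (dist_lt_of_mem_uIcc hy hyc))
    have hc : ∀ i ≤ n, dist (f^[i] c) (f^[i] x) ≤ ε := by
      intro i hi
      by_contra hgt
      rw [not_le] at hgt
      obtain ⟨c', hc', hc'ε⟩ := intermediate_value_uIcc (a := x) (b := c) (hcont i).continuousOn
        (show ε ∈ _ from mem_uIcc.2 (Or.inl ⟨by simpa using hε.le, hgt.le⟩))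
      refine hlt c' hc' ?_ ((hmemE c').2 ⟨i, hi, hc'ε.ge⟩)
      rintro rfl
      exact hgt.ne' hc'ε
    refine ⟨x, c, fun y hy i hi => ?_, ?_⟩
    · rcases eq_or_ne y c with rfl | hyc
      · exact hc i hi
      · by_contra hgt
        exact hlt y hy hyc ((hmemE y).2 ⟨i, hi, (not_le.1 hgt).le⟩)
    · obtain ⟨i, hi, hdist⟩ := (hmemE c).1 hcE
      obtain ⟨u, ⟨s, hs', rfl⟩, v, ⟨t, ht', rfl⟩, huv⟩ := hδ (f^[i] '' uIcc x c)
        (ordConnected_image (f.continuous.iterate i) ordConnected_uIcc)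
        _ ⟨c, right_mem_uIcc, rfl⟩ _ ⟨x, left_mem_uIcc, rfl⟩ hdist (n - i)
      refine ⟨s, hs', t, ht', (min_le_left _ _).trans ?_⟩
      rwa [← iterate_add_apply, ← iterate_add_apply, Nat.sub_add_cancel hi] at huv

/-- Orbit segments are traced by chaining shadowing intervals: after the common covering time, the
image of each of them covers the next one, and finally the first one. -/
theorem IsLeo.periodicSpecification {f : C(I, I)} (hf : IsLeo f) (hs : Surjective f) :
    PeriodicSpecification f := by
  intro ε hε
  obtain ⟨δ, hδ0, hδ⟩ := hf.exists_shadowing_interval hs hε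
  obtain ⟨N, hN⟩ := hf.exists_covering_time hs hδ0
  refine ⟨N + 1, by omega, fun p x a b hab hgap q hq => ?_⟩
  choose u v huv s hsuv t htuv hst using fun i => hδ (f^[a i] (x i)) (b i - a i)
  have hcov : ∀ i, ∀ m, N + (b i - a i) ≤ m → f^[m] '' uIcc (u i) (v i) = univ := by
    intro i m hm
    obtain ⟨k, rfl⟩ := Nat.exists_eq_add_of_le' hm
    rw [← add_assoc, iterate_add, image_comp]
    exact hN _ (ordConnected_image (f.continuous.iterate _) ordConnected_uIcc) _
      ⟨_, hsuv i, rfl⟩ _ ⟨_, htuv i, rfl⟩ (hst i) _ (by omega)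
  have chain : ∀ j : Fin (p + 1), a 0 ≤ a j ∧ ∃ r w : I,
      uIcc r w ⊆ uIcc (u 0) (v 0) ∧
      (∀ i ≤ j, f^[a i - a 0] '' uIcc r w ⊆ uIcc (u i) (v i)) ∧
      f^[a j - a 0] '' uIcc r w = uIcc (u j) (v j) := by
    intro j
    induction j using Fin.induction with
    | zero =>
      refine ⟨le_rfl, u 0, v 0, Subset.rfl, fun i hi => ?_, by simp⟩
      obtain rfl : i = 0 := Fin.le_zero_iff.1 hi
      simp
    | succ j ih =>
      obtain ⟨h0, r, w, hsub, hprev, heq⟩ := ih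
      have hj := hgap j
      have hj' := hab j.castSucc
      have hcovj : f^[a j.succ - a 0] '' uIcc r w = univ := by
        have hsplit : a j.succ - a 0 =
            (a j.succ - a j.castSucc) + (a j.castSucc - a 0) := by omega
        rw [hsplit, iterate_add, image_comp, heq]
        exact hcov _ _ (by omega)
      obtain ⟨r', hr', w', hw', himg⟩ := exists_uIcc_image_eq
        (f.continuous.iterate (a j.succ - a 0)) (u := r) (v := w)
        (inf_le_sup (a := u j.succ) (b := v j.succ)) (by rw [hcovj]; exact subset_univ _)
      have hsub' : uIcc r' w' ⊆ uIcc r w := uIcc_subset_uIcc hr' hw'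
      refine ⟨by omega, r', w', hsub'.trans hsub, fun i hi => ?_, himg⟩
      rcases hi.lt_or_eq with hlt | rfl
      · exact (image_mono hsub').trans (hprev i (Fin.le_castSucc_iff.2 hlt))
      · exact himg.subset
  obtain ⟨h0, r, w, -, hprev, heq⟩ := chain (Fin.last p)
  have hablast := hab (Fin.last p)
  have hq' : f^[q] '' uIcc r w = univ := by
    have hsplit : q = (q - (a (Fin.last p) - a 0)) + (a (Fin.last p) - a 0) := by omega
    rw [hsplit, iterate_add, image_comp, heq]
    exact hcov _ _ (by omega)
  obtain ⟨z, hz, hfix⟩ := exists_fixedPt_of_subset_image (f.continuous.iterate q)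
    (S := uIcc r w) ordConnected_uIcc (u := r ⊓ w) (v := r ⊔ w)
    (left_mem_Icc.2 inf_le_sup) (right_mem_Icc.2 inf_le_sup) Subset.rfl
    (by rw [hq']; exact subset_univ _)
  have hq1 : 1 ≤ q := by omega
  have hper : IsPeriodicPt f q z := hfix
  -- the point of the orbit of `z` that arrives at `z` at time `a 0`
  have hya : f^[a 0] (f^[q * a 0 - a 0] z) = z := by
    rw [← iterate_add_apply,
      Nat.add_sub_cancel' (Nat.le_mul_of_pos_left (a 0) hq1)]
    exact (hper.mul_const (a 0))
  refine ⟨f^[q * a 0 - a 0] z, (hper.apply_iterate _), fun i n hn1 hn2 => ?_⟩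
  have h0i := (chain i).1
  have hn : n = (n - a i) + ((a i - a 0) + a 0) := by omega
  have hz' : f^[n] (f^[q * a 0 - a 0] z) = f^[n - a i] (f^[a i - a 0] z) := by
    conv_lhs => rw [hn, iterate_add_apply, iterate_add_apply, hya]
  have hx' : f^[n] (x i) = f^[n - a i] (f^[a i] (x i)) := by
    rw [← iterate_add_apply, Nat.sub_add_cancel hn1]
  rw [hz', hx']
  exact huv i _ (hprev i (Fin.le_last i) ⟨z, hz, rfl⟩) _ (by omega)

/-! ### Maps with dense periodic points: a criterion for leo, and openness -/

theorem periodicPts_eq_of_iterate_eq {α : Type*} {f : α → α} {x y : α} (hx : x ∈ periodicPts f)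
    (hy : y ∈ periodicPts f) {n : ℕ} (h : f^[n] x = f^[n] y) : x = y := by
  obtain ⟨k, hk, hxk⟩ := hx
  obtain ⟨l, hl, hyl⟩ := hy
  -- both points return at time `n * (k * l) ≥ n`
  have h1 : f^[n * (k * l)] x = x := (hxk.mul_const l).const_mul n
  have h2 : f^[n * (k * l)] y = y := (hyl.const_mul k).const_mul n
  have hle : n ≤ n * (k * l) := Nat.le_mul_of_pos_right n (Nat.mul_pos hk hl)
  rw [← h1, ← h2, ← Nat.sub_add_cancel hle, iterate_add_apply, iterate_add_apply, h]

theorem exists_lt_of_nontrivial {S : Set I} (hS : S.OrdConnected) (hn : S.Nontrivial) :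
    ∃ a b, a < b ∧ Icc a b ⊆ S := by
  obtain ⟨a, ha, b, hb, hab⟩ := hn
  rcases lt_or_gt_of_ne hab with h | h
  · exact ⟨a, b, h, hS.out ha hb⟩
  · exact ⟨b, a, h, hS.out hb ha⟩

theorem exists_periodic_pair {g : C(I, I)} (hg : g ∈ CP) {a b : I} (hab : a < b) :
    ∃ p ∈ periodicPts g, ∃ q ∈ periodicPts g, p < q ∧ a < p ∧ q < b := by
  obtain ⟨p, hp, hap, hpb⟩ := hg.2.exists_between hab
  obtain ⟨q, hq, hpq, hqb⟩ := hg.2.exists_between hpb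
  exact ⟨p, hp, q, hq, hpq, hap, hqb⟩

/-- Two periodic points are never identified by an iterate, so a map with dense periodic points
collapses no interval to a point. -/
theorem nontrivial_image {g : C(I, I)} (hg : g ∈ CP) {S : Set I} (hS : S.OrdConnected)
    (hn : S.Nontrivial) : (g '' S).Nontrivial := by
  obtain ⟨a, b, hab, hsub⟩ := exists_lt_of_nontrivial hS hn
  obtain ⟨p, hp, q, hq, hpq, hap, hqb⟩ := exists_periodic_pair hg hab
  refine ⟨g p, ⟨p, hsub ⟨hap.le, (hpq.trans hqb).le⟩, rfl⟩, g q,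
    ⟨q, hsub ⟨(hap.trans hpq).le, hqb.le⟩, rfl⟩, fun h => hpq.ne ?_⟩
  exact periodicPts_eq_of_iterate_eq hp hq (n := 1) h

/-- If the periodic points are dense, a point outside a forward invariant set cannot enter its
interior: nearby periodic points would have to come back. -/
theorem iterate_notMem_interior {g : C(I, I)} (hg : g ∈ CP) {A : Set I} (hA : IsClosed A) {n : ℕ}
    (hinv : MapsTo g^[n] A A) {x : I} (hx : x ∉ A) : g^[n] x ∉ interior A := by
  intro hxA
  have hopen : IsOpen (Aᶜ ∩ g^[n] ⁻¹' interior A) :=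
    hA.isOpen_compl.inter (isOpen_interior.preimage (g.continuous.iterate n))
  obtain ⟨r, ⟨hrA, hrA'⟩, k, hk, hrk⟩ := hg.2.inter_open_nonempty _ hopen ⟨x, hx, hxA⟩
  have h1 : (g^[n])^[k] r = r := by
    rw [← iterate_mul]
    exact hrk.const_mul n
  obtain ⟨k, rfl⟩ := Nat.exists_eq_succ_of_ne_zero hk.ne'
  rw [iterate_succ_apply] at h1
  refine hrA ?_
  rw [← h1]
  exact hinv.iterate k (interior_subset hrA')

/-- The point `c` of `(0,1)` separates `[0,1]` into two intervals that are both invariant under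
some iterate of `g`. -/
def Separates (g : C(I, I)) (c : I) : Prop :=
  0 < c ∧ c < 1 ∧ ∃ n : ℕ, 0 < n ∧ MapsTo g^[n] (Iic c) (Iic c) ∧ MapsTo g^[n] (Ici c) (Ici c)

theorem maps_le_of_maps_ge {g : C(I, I)} (hg : g ∈ CP) {c : I} (h0 : 0 < c) {n : ℕ}
    (h : MapsTo g^[n] (Ici c) (Ici c)) : MapsTo g^[n] (Iic c) (Iic c) := by
  have key : MapsTo g^[n] (Iio c) (Iic c) := fun x hx => by
    have := iterate_notMem_interior hg isClosed_Ici h (x := x) (by simpa using hx)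
    by_contra hlt
    rw [mem_Iic, not_le] at hlt
    exact this (interior_maximal Ioi_subset_Ici_self isOpen_Ioi hlt)
  have := key.closure (g.continuous.iterate n)
  rwa [closure_Iio' (show (Iio c).Nonempty from ⟨0, h0⟩), isClosed_Iic.closure_eq] at this

theorem maps_ge_of_maps_le {g : C(I, I)} (hg : g ∈ CP) {c : I} (h1 : c < 1) {n : ℕ}
    (h : MapsTo g^[n] (Iic c) (Iic c)) : MapsTo g^[n] (Ici c) (Ici c) := by
  have key : MapsTo g^[n] (Ioi c) (Ici c) := fun x hx => by
    have := iterate_notMem_interior hg isClosed_Iic h (x := x) (by simpa using hx)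
    by_contra hlt
    rw [mem_Ici, not_le] at hlt
    exact this (interior_maximal Iio_subset_Iic_self isOpen_Iio hlt)
  have := key.closure (g.continuous.iterate n)
  rwa [closure_Ioi' (show (Ioi c).Nonempty from ⟨1, h1⟩), isClosed_Ici.closure_eq] at this

/-- A proper interval that is invariant under an iterate yields a separating point, namely one of
its endpoints: the intervals on its two sides are invariant, or exchanged. -/
theorem exists_separates_of_invariant {g : C(I, I)} (hg : g ∈ CP) {n : ℕ} (hn : 0 < n) {a b : I}
    (hab : a < b) (hproper : 0 < a ∨ b < 1) (hinv : MapsTo g^[n] (Icc a b) (Icc a b)) :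
    ∃ c, Separates g c := by
  have hcont := g.continuous.iterate n
  have hsurj : Surjective g^[n] := hg.1.iterate n
  have key : ∀ x, x ∉ Icc a b → g^[n] x ∈ (Ioo a b)ᶜ := fun x hx hgx =>
    iterate_notMem_interior hg isClosed_Icc hinv hx
      (interior_maximal Ioo_subset_Icc_self isOpen_Ioo hgx)
  -- an interval whose image misses `(a, b)` is mapped to one side of `(a, b)`
  have hside : ∀ S : Set I, S.OrdConnected → MapsTo g^[n] S (Ioo a b)ᶜ →
      (∀ x ∈ S, g^[n] x ≤ a) ∨ ∀ x ∈ S, b ≤ g^[n] x := by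
    intro S hS hout
    by_contra hcon
    push Not at hcon
    obtain ⟨⟨x, hx, hxa⟩, y, hy, hyb⟩ := hcon
    have hxb : b ≤ g^[n] x := by
      by_contra hlt
      exact hout hx ⟨hxa, not_le.1 hlt⟩
    have hya : g^[n] y ≤ a := by
      by_contra hlt
      exact hout hy ⟨not_le.1 hlt, hyb⟩
    obtain ⟨m, ham, hmb⟩ := exists_between hab
    obtain ⟨z, hz, hzm⟩ := (ordConnected_image hcont hS).out ⟨y, hy, rfl⟩ ⟨x, hx, rfl⟩
      ⟨hya.trans ham.le, hmb.le.trans hxb⟩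
    exact hout hz (by rw [hzm]; exact ⟨ham, hmb⟩)
  have hL (h0 : 0 < a) := hside (Iic a) ordConnected_Iic <| by
    have h := MapsTo.closure (s := Iio a) (t := (Ioo a b)ᶜ)
      (fun x hx => key x fun hx' => absurd hx'.1 (not_le.2 hx)) hcont
    rwa [closure_Iio' (show (Iio a).Nonempty from ⟨0, h0⟩),
      isOpen_Ioo.isClosed_compl.closure_eq] at h
  have hR (h1 : b < 1) := hside (Ici b) ordConnected_Ici <| by
    have h := MapsTo.closure (s := Ioi b) (t := (Ioo a b)ᶜ)
      (fun x hx => key x fun hx' => absurd hx'.2 (not_le.2 hx)) hcont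
    rwa [closure_Ioi' (show (Ioi b).Nonempty from ⟨1, h1⟩),
      isOpen_Ioo.isClosed_compl.closure_eq] at h
  rcases hproper with h0 | h1
  · suffices ∃ m, 0 < m ∧ MapsTo g^[m] (Iic a) (Iic a) by
      obtain ⟨m, hm, hmaps⟩ := this
      exact ⟨a, h0, hab.trans_le le_top, m, hm, hmaps,
        maps_ge_of_maps_le hg (hab.trans_le le_top) hmaps⟩
    rcases hL h0 with hL | hL
    · exact ⟨n, hn, hL⟩
    · have h1 : b < 1 := by
        -- otherwise `[0, a]` would be collapsed to the point `1`
        by_contra hb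
        obtain ⟨p, hp, q, hq, hpq, -, hqa⟩ := exists_periodic_pair hg h0
        have hbq := hL q hqa.le
        have hbp := hL p (hpq.trans hqa).le
        have hb1 := not_lt.1 hb
        exact hpq.ne (periodicPts_eq_of_iterate_eq hp hq (n := n)
          ((le_antisymm le_top (hb1.trans hbp)).trans
            (le_antisymm le_top (hb1.trans hbq)).symm))
      refine ⟨n + n, by omega, fun x hx => ?_⟩
      rw [iterate_add_apply]
      rcases hR h1 with hR | hR
      · exact hR _ (hL x hx)
      · obtain ⟨z, hz⟩ := hsurj 0
        exfalso
        rcases le_total z a with hza | hza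
        · have := hL z hza
          rw [hz] at this
          exact absurd (hab.trans_le this) (not_lt.2 bot_le)
        · rcases le_total z b with hzb | hzb
          · have := (hinv ⟨hza, hzb⟩).1
            rw [hz] at this
            exact absurd h0 (not_lt.2 this)
          · have := hR z hzb
            rw [hz] at this
            exact absurd (hab.trans_le this) (not_lt.2 bot_le)
  · suffices ∃ m, 0 < m ∧ MapsTo g^[m] (Ici b) (Ici b) by
      obtain ⟨m, hm, hmaps⟩ := this
      exact ⟨b, (bot_le (a := a)).trans_lt hab, h1, m, hm,
        maps_le_of_maps_ge hg ((bot_le (a := a)).trans_lt hab) hmaps, hmaps⟩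
    rcases hR h1 with hR | hR
    · have h0 : 0 < a := by
        by_contra ha
        obtain ⟨p, hp, q, hq, hpq, hbp, -⟩ := exists_periodic_pair hg h1
        have haq := hR q (hbp.trans hpq).le
        have hap := hR p hbp.le
        have ha0 := not_lt.1 ha
        exact hpq.ne (periodicPts_eq_of_iterate_eq hp hq (n := n)
          ((le_antisymm (hap.trans ha0) bot_le).trans
            (le_antisymm (haq.trans ha0) bot_le).symm))
      refine ⟨n + n, by omega, fun x hx => ?_⟩
      rw [iterate_add_apply]
      rcases hL h0 with hL | hL
      · obtain ⟨z, hz⟩ := hsurj 1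
        exfalso
        rcases le_total z a with hza | hza
        · have := hL z hza
          rw [hz] at this
          exact absurd (this.trans_lt hab) (not_lt.2 le_top)
        · rcases le_total z b with hzb | hzb
          · have := (hinv ⟨hza, hzb⟩).2
            rw [hz] at this
            exact absurd h1 (not_lt.2 this)
          · have := hR z hzb
            rw [hz] at this
            exact absurd (this.trans_lt hab) (not_lt.2 le_top)
      · exact hL _ (hR x hx)
    · exact ⟨n, hn, hR⟩

theorem mem_Ioo_of_movesEndpointsInside {g : C(I, I)} (h : MovesEndpointsInside g) :
    g 0 ∈ Ioo (0 : I) 1 ∧ g 1 ∈ Ioo (0 : I) 1 := by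
  have key : ∀ e : I, e = 0 ∨ e = 1 → g e ∈ Ioo (0 : I) 1 := fun e he => by
    have hne : g e ∉ ({0, 1} : Set I) := fun hmem => by
      have : g e ∈ (g '' {0, 1}) ∩ {0, 1} := ⟨⟨e, he, rfl⟩, hmem⟩
      rw [h] at this
      exact this
    rw [mem_insert_iff, mem_singleton_iff, not_or] at hne
    exact ⟨bot_lt_iff_ne_bot.2 hne.1, lt_top_iff_ne_top.2 hne.2⟩
  exact ⟨key 0 (Or.inl rfl), key 1 (Or.inr rfl)⟩

theorem movesEndpointsInside_of_mem_Ioo {g : C(I, I)} (h0 : g 0 ∈ Ioo (0 : I) 1)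
    (h1 : g 1 ∈ Ioo (0 : I) 1) : MovesEndpointsInside g := by
  refine eq_empty_of_forall_notMem ?_
  rintro _ ⟨⟨e, rfl | rfl, rfl⟩, h | h⟩
  · exact h0.1.ne' h
  · exact h0.2.ne h
  · exact h1.1.ne' h
  · exact h1.2.ne h

/-- A map with dense periodic points that moves the endpoints inside and has no separating point
is leo. Two periodic points `p < q` in an open set are fixed by some iterate `h`, so the intervals
`h^k [p, q]` increase; their union is dense, as its closure has no endpoint in `(0,1)`, and
therefore eventually contains preimages of `0` and of `1`. -/
theorem isLeo_of_forall_not_separates {g : C(I, I)} (hg : g ∈ CP) (hend : MovesEndpointsInside g)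
    (hsep : ∀ c, ¬ Separates g c) : IsLeo g := by
  intro U hU hne
  obtain ⟨b, c, hbc, hsub⟩ := exists_Icc_subset hU hne
  obtain ⟨p, ⟨k, hk, hpk⟩, q, ⟨l, hl, hql⟩, hpq, hbp, hqc⟩ := exists_periodic_pair hg hbc
  have hn : 0 < k * l := Nat.mul_pos hk hl
  have hp : g^[k * l] p = p := hpk.mul_const l
  have hq : g^[k * l] q = q := hql.const_mul k
  set n := k * l with hn_def
  clear_value n
  have hcont := g.continuous.iterate n
  let S : ℕ → Set I := fun m => (g^[n])^[m] '' Icc p q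
  have hS : ∀ m, (S m).OrdConnected := fun m =>
    ordConnected_image (hcont.iterate m) ordConnected_Icc
  have hpS : ∀ m, p ∈ S m := fun m => ⟨p, left_mem_Icc.2 hpq.le, iterate_fixed hp m⟩
  have hqS : ∀ m, q ∈ S m := fun m => ⟨q, right_mem_Icc.2 hpq.le, iterate_fixed hq m⟩
  have hmono : Monotone S := by
    refine monotone_nat_of_le_succ fun m => ?_
    change _ '' _ ⊆ _ '' _
    rw [iterate_succ, image_comp]
    exact image_mono ((ordConnected_image hcont ordConnected_Icc).out
      ⟨p, left_mem_Icc.2 hpq.le, hp⟩ ⟨q, right_mem_Icc.2 hpq.le, hq⟩)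
  have hL : (⋃ m, S m).OrdConnected := by
    refine ⟨fun x hx y hy => ?_⟩
    obtain ⟨i, hi⟩ := mem_iUnion.1 hx
    obtain ⟨j, hj⟩ := mem_iUnion.1 hy
    exact ((hS (max i j)).out (hmono (le_max_left _ _) hi) (hmono (le_max_right _ _) hj)).trans
      (subset_iUnion S _)
  have hLinv : MapsTo g^[n] (⋃ m, S m) (⋃ m, S m) := by
    intro x hx
    obtain ⟨m, y, hy, rfl⟩ := mem_iUnion.1 hx
    exact mem_iUnion.2 ⟨m + 1, y, hy, iterate_succ_apply' _ _ _⟩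
  by_cases hfull : Ioo (0 : I) 1 ⊆ ⋃ m, S m
  · obtain ⟨he0, he1⟩ := mem_Ioo_of_movesEndpointsInside hend
    have hpre : ∀ e : I, e = 0 ∨ e = 1 → ∃ m, ∃ x ∈ S m, g x = e := by
      intro e he
      obtain ⟨x, rfl⟩ := hg.1 e
      have hx : x ∈ Ioo (0 : I) 1 := by
        refine ⟨bot_lt_iff_ne_bot.2 ?_, lt_top_iff_ne_top.2 ?_⟩
        · rintro rfl
          rcases he with he | he
          · exact he0.1.ne' he
          · exact he0.2.ne he
        · rintro rfl
          rcases he with he | he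
          · exact he1.1.ne' he
          · exact he1.2.ne he
      obtain ⟨m, hm⟩ := mem_iUnion.1 (hfull hx)
      exact ⟨m, x, hm, rfl⟩
    obtain ⟨i, x, hx, hx0⟩ := hpre 0 (Or.inl rfl)
    obtain ⟨j, y, hy, hy1⟩ := hpre 1 (Or.inr rfl)
    refine ⟨1 + n * max i j, eq_univ_of_univ_subset ?_⟩
    have huniv := eq_univ_of_zero_mem_of_one_mem
      (ordConnected_image g.continuous (hS (max i j)))
      ⟨x, hmono (le_max_left _ _) hx, hx0⟩ ⟨y, hmono (le_max_right _ _) hy, hy1⟩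
    rw [← huniv, iterate_add, iterate_mul, image_comp]
    exact image_mono (image_mono ((Icc_subset_Icc hbp.le hqc.le).trans hsub))
  · exfalso
    obtain ⟨t, ht, htL⟩ := not_subset.1 hfull
    have hpL : p ∈ ⋃ m, S m := mem_iUnion.2 ⟨0, hpS 0⟩
    have hqL : q ∈ ⋃ m, S m := mem_iUnion.2 ⟨0, hqS 0⟩
    have hclosed : closure (⋃ m, S m) = Icc (sInf (closure (⋃ m, S m)))
        (sSup (closure (⋃ m, S m))) := by
      refine eq_Icc_of_connected_compact ⟨⟨p, subset_closure hpL⟩, ?_⟩ isClosed_closure.isCompact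
      exact hL.isPreconnected.closure
    set a := sInf (closure (⋃ m, S m))
    set b' := sSup (closure (⋃ m, S m))
    have hpc : p ∈ Icc a b' := hclosed ▸ subset_closure hpL
    have hqc : q ∈ Icc a b' := hclosed ▸ subset_closure hqL
    have hinv : MapsTo g^[n] (Icc a b') (Icc a b') := by
      rw [← hclosed]
      exact hLinv.closure hcont
    have hproper : 0 < a ∨ b' < 1 := by
      rcases lt_or_ge t p with htp | htp
      · left
        have : closure (⋃ m, S m) ⊆ Ici t := by
          refine closure_minimal (fun x hx => ?_) isClosed_Ici
          by_contra hxt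
          exact htL (hL.out hx hpL ⟨(not_le.1 hxt).le, htp.le⟩)
        rw [hclosed] at this
        exact ht.1.trans_le (this (left_mem_Icc.2 (hpc.1.trans hpc.2)))
      · right
        have : closure (⋃ m, S m) ⊆ Iic t := by
          refine closure_minimal (fun x hx => ?_) isClosed_Iic
          by_contra hxt
          exact htL (hL.out hpL hx ⟨htp, (not_le.1 hxt).le⟩)
        rw [hclosed] at this
        exact (this (right_mem_Icc.2 (hpc.1.trans hpc.2))).trans_lt ht.2
    obtain ⟨c', hc'⟩ := exists_separates_of_invariant hg hn (hpc.1.trans_lt (hpq.trans_le hqc.2))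
      hproper hinv
    exact hsep c' hc'

/-- If the images of both sides of `c` share an interval, then `c` does not separate. -/
theorem not_separates_of_overlap {g : C(I, I)} (hg : g ∈ CP) {c : I}
    (h : (g '' Iic c ∩ g '' Ici c).Nontrivial) : ¬ Separates g c := by
  rintro ⟨-, -, n, hn, hle, hge⟩
  obtain ⟨n, rfl⟩ := Nat.exists_eq_succ_of_ne_zero hn.ne'
  obtain ⟨a, b, hab, hsub⟩ := exists_lt_of_nontrivial
    ((ordConnected_image g.continuous ordConnected_Iic).inter
      (ordConnected_image g.continuous ordConnected_Ici)) h
  obtain ⟨p, hp, q, hq, hpq, hap, hqb⟩ := exists_periodic_pair hg hab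
  -- points in both images arrive at `c` itself after `n` more steps
  have key : ∀ x ∈ Icc a b, g^[n] x = c := fun x hx => by
    obtain ⟨⟨y, hy, hyx⟩, z, hz, hzx⟩ := hsub hx
    have h1 := hle hy
    have h2 := hge hz
    rw [iterate_succ_apply, hyx] at h1
    rw [iterate_succ_apply, hzx] at h2
    exact le_antisymm h1 h2
  exact hpq.ne (periodicPts_eq_of_iterate_eq hp hq
    ((key p ⟨hap.le, (hpq.trans hqb).le⟩).trans (key q ⟨(hap.trans hpq).le, hqb.le⟩).symm))

/-- If some iterate maps both halves of `[0,1]` onto `[0,1]`, there is no separating point, as one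
of the two invariant intervals would contain a half. -/
theorem not_separates_of_halves {g : C(I, I)} (hg : g ∈ CP) {t : I} {n : ℕ}
    (h1 : g^[n] '' Iic t = univ) (h2 : g^[n] '' Ici t = univ) (c : I) : ¬ Separates g c := by
  rintro ⟨hc0, hc1, m, hm, hle, hge⟩
  have hnm : n ≤ m * n := Nat.le_mul_of_pos_left n hm
  rcases le_total t c with htc | htc
  · obtain ⟨x, hx, hx1⟩ := (image_iterate_eq_univ_of_le hg.1 hnm h1).symm ▸ mem_univ (1 : I)
    have := hle.iterate n (le_trans hx htc : x ≤ c)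
    rw [← iterate_mul, hx1] at this
    exact absurd hc1 (not_lt.2 this)
  · obtain ⟨x, hx, hx0⟩ := (image_iterate_eq_univ_of_le hg.1 hnm h2).symm ▸ mem_univ (0 : I)
    have := hge.iterate n (le_trans htc hx : c ≤ x)
    rw [← iterate_mul, hx0] at this
    exact absurd hc0 (not_lt.2 this)

theorem continuous_iterate_apply (x : I) (n : ℕ) : Continuous fun g : C(I, I) => g^[n] x := by
  induction n with
  | zero => exact continuous_const
  | succ n ih =>
    simp only [iterate_succ_apply']
    exact continuous_eval.comp (continuous_id.prodMk ih)

/-- Close to a leo map that moves the endpoints inside, every map with dense periodic points has an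
iterate that sends both halves of `[0,1]` onto `[0,1]`: the preimages of the endpoints stay away
from the endpoints, so it suffices to cover an interval `[δ, 1 - δ]`. -/
theorem eventually_isLeo {f : C(I, I)} (hf : IsLeo f) (hs : Surjective f)
    (hend : MovesEndpointsInside f) :
    ∀ᶠ g in 𝓝 f, g ∈ CP → IsLeo g ∧ MovesEndpointsInside g := by
  obtain ⟨he0, he1⟩ := mem_Ioo_of_movesEndpointsInside hend
  obtain ⟨d, hd0, hd⟩ : ∃ d : I, 0 < d ∧ ∀ x ≤ d, f x ∈ Ioo (0 : I) 1 := by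
    have := (f.continuous.tendsto 0).eventually (isOpen_Ioo.mem_nhds he0)
    obtain ⟨d, hd, hsub⟩ := exists_Ico_subset_of_mem_nhds this ⟨1, zero_lt_one⟩
    obtain ⟨e, he0, hed⟩ := exists_between hd
    exact ⟨e, he0, fun x hx => hsub ⟨bot_le, hx.trans_lt hed⟩⟩
  obtain ⟨d', hd'1, hd'⟩ : ∃ d : I, d < 1 ∧ ∀ x, d ≤ x → f x ∈ Ioo (0 : I) 1 := by
    have := (f.continuous.tendsto 1).eventually (isOpen_Ioo.mem_nhds he1)
    obtain ⟨d, hd, hsub⟩ := exists_Ioc_subset_of_mem_nhds this ⟨0, zero_lt_one⟩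
    obtain ⟨e, he0, hed⟩ := exists_between hd
    exact ⟨e, hed, fun x hx => hsub ⟨he0.trans_le hx, le_top⟩⟩
  obtain ⟨t, ht0, ht1⟩ := exists_between (zero_lt_one (α := I))
  obtain ⟨n1, hn1⟩ := hf (Iio t) isOpen_Iio ⟨0, ht0⟩
  obtain ⟨n2, hn2⟩ := hf (Ioi t) isOpen_Ioi ⟨1, ht1⟩
  have h1 := image_iterate_eq_univ_of_le hs (le_max_left n1 n2) hn1
  have h2 := image_iterate_eq_univ_of_le hs (le_max_right n1 n2) hn2
  set n := max n1 n2
  obtain ⟨x0, hx0, hfx0⟩ := h1.symm ▸ mem_univ (0 : I)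
  obtain ⟨x1, hx1, hfx1⟩ := h1.symm ▸ mem_univ (1 : I)
  obtain ⟨y0, hy0, hfy0⟩ := h2.symm ▸ mem_univ (0 : I)
  obtain ⟨y1, hy1, hfy1⟩ := h2.symm ▸ mem_univ (1 : I)
  have hK : ∀ᶠ g : C(I, I) in 𝓝 f, MapsTo g (Iic d ∪ Ici d') (Ioo (0 : I) 1) :=
    (ContinuousMap.isOpen_setOfPred_mapsTo
      ((isClosed_Iic.union isClosed_Ici).isCompact) isOpen_Ioo).mem_nhds
      (by rintro x (hx | hx); exacts [hd x hx, hd' x hx])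
  have hlow : ∀ x, f^[n] x = 0 → ∀ᶠ g : C(I, I) in 𝓝 f, g^[n] x < d := fun x hx =>
    ((continuous_iterate_apply x n).tendsto f).eventually (gt_mem_nhds (by rwa [hx]))
  have hhigh : ∀ x, f^[n] x = 1 → ∀ᶠ g : C(I, I) in 𝓝 f, d' < g^[n] x := fun x hx =>
    ((continuous_iterate_apply x n).tendsto f).eventually (lt_mem_nhds (by rwa [hx]))
  filter_upwards [hK, hlow x0 hfx0, hhigh x1 hfx1, hlow y0 hfy0, hhigh y1 hfy1] with
    g hgK hgx0 hgx1 hgy0 hgy1 hg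
  have hcov : ∀ S : Set I, S.OrdConnected → ∀ x ∈ S, ∀ y ∈ S, g^[n] x < d → d' < g^[n] y →
      g^[1 + n] '' S = univ := by
    intro S hS x hx y hy hxd hyd
    have hSn := ordConnected_image (g.continuous.iterate n) hS
    have hpre : ∀ e : I, e = 0 ∨ e = 1 → e ∈ g^[1 + n] '' S := by
      intro e he
      obtain ⟨z, rfl⟩ := hg.1 e
      rw [iterate_add, image_comp]
      have hz : ¬ (z ∈ Iic d ∪ Ici d') := fun hz => by
        have := hgK hz
        rcases he with he | he
        · exact this.1.ne' he
        · exact this.2.ne he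
      rw [mem_union, not_or, mem_Iic, mem_Ici, not_le, not_le] at hz
      exact ⟨z, hSn.out ⟨x, hx, rfl⟩ ⟨y, hy, rfl⟩ ⟨(hxd.trans hz.1).le, (hz.2.trans hyd).le⟩, rfl⟩
    exact eq_univ_of_zero_mem_of_one_mem (ordConnected_image (g.continuous.iterate _) hS)
      (hpre 0 (Or.inl rfl)) (hpre 1 (Or.inr rfl))
  have hgend : MovesEndpointsInside g := movesEndpointsInside_of_mem_Ioo
    (hgK (Or.inl (bot_le : (0 : I) ≤ d))) (hgK (Or.inr (le_top : d' ≤ (1 : I))))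
  exact ⟨isLeo_of_forall_not_separates hg hgend (not_separates_of_halves hg
    (hcov _ ordConnected_Iic x0 (Iio_subset_Iic_self hx0) x1 (Iio_subset_Iic_self hx1) hgx0 hgx1)
    (hcov _ ordConnected_Ici y0 (Ioi_subset_Ici_self hy0) y1 (Ioi_subset_Ici_self hy1)
      hgy0 hgy1)), hgend⟩

theorem isOpen_leo {X : Set C(I, I)} (hX : X ⊆ CP) :
    IsOpen {f : X | IsLeo f.1 ∧ MovesEndpointsInside f.1} := by
  rw [isOpen_iff_mem_nhds]
  intro f hf
  have := continuous_subtype_val.continuousAt.eventually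
    (eventually_isLeo hf.1 (hX f.2).1 hf.2)
  filter_upwards [this] with g hg
  exact hg (hX g.2)

/-! ### Maps preserving a measure -/

section Recurrence

variable {α : Type*} [ConditionallyCompleteLinearOrder α] [TopologicalSpace α] [OrderTopology α]
  [DenselyOrdered α]

/-- If an interval `J` contains no periodic point and some point of `J` returns to `J` at time `n`
further to the right, then all points of `J` are to the left of their images at all multiples
of `n`. -/
theorem lt_iterate_of_forall_notMem_periodicPts {f : α → α} (hf : Continuous f) {J : Set α}
    (hJ : J.OrdConnected) (hper : ∀ x ∈ J, x ∉ periodicPts f) {x : α} (hx : x ∈ J) {n : ℕ}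
    (hn : f^[n] x ∈ J) (hlt : x < f^[n] x) (k : ℕ) : ∀ y ∈ J, y < f^[n * (k + 1)] y := by
  have hn0 : 0 < n := Nat.pos_of_ne_zero (by rintro rfl; exact lt_irrefl _ hlt)
  -- without fixed points, the sign of `f^[m] y - y` is constant on `J`
  have sign : ∀ m, 0 < m → ∀ z ∈ J, z < f^[m] z → ∀ y ∈ J, y < f^[m] y := by
    intro m hm z hz hzlt y hy
    by_contra hle
    obtain ⟨c, hc, hfix⟩ := exists_mem_uIcc_isFixedPt (f := f^[m]) (a := z) (b := y)
      (hf.iterate m).continuousOn hzlt.le (not_lt.1 hle)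
    exact hper c (hJ.uIcc_subset hz hy hc) ⟨m, hm, hfix⟩
  induction k with
  | zero => simpa using sign n hn0 x hx hlt
  | succ k ih =>
    refine sign _ (by positivity) x hx (hlt.trans ?_)
    have := ih _ hn
    rwa [← iterate_add_apply, ← mul_add_one] at this

end Recurrence

/-- In an interval without periodic points, all returns go in the same direction. -/
theorem false_of_returns {f : I → I} (hf : Continuous f) {J : Set I} (hJ : J.OrdConnected)
    (hper : ∀ x ∈ J, x ∉ periodicPts f) {x y : I} {n m : ℕ} (hx : x ∈ J) (hn : f^[n] x ∈ J)
    (hlt : x < f^[n] x) (hy : y ∈ J) (hm : f^[m] y ∈ J) (hgt : f^[m] y < y) : False := by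
  have hn0 : 0 < n := Nat.pos_of_ne_zero (by rintro rfl; exact lt_irrefl _ hlt)
  have hm0 : 0 < m := Nat.pos_of_ne_zero (by rintro rfl; exact lt_irrefl _ hgt)
  have h1 := lt_iterate_of_forall_notMem_periodicPts hf hJ hper hx hn hlt (m - 1) x hx
  have h2 := lt_iterate_of_forall_notMem_periodicPts (α := Iᵒᵈ) (f := f) hf hJ.dual
    hper hy hm hgt (n - 1) x hx
  rw [Nat.sub_add_cancel hm0] at h1
  rw [Nat.sub_add_cancel hn0, mul_comm] at h2
  exact lt_asymm h1 h2

/-- A map preserving a finite measure of full support has dense periodic points. By Poincaré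
recurrence an open interval contains a recurrent point; its returns happen on both sides. -/
theorem cmeas_subset_CP (μ : Measure I) [IsFiniteMeasure μ] [μ.IsOpenPosMeasure] :
    Cmeas μ ⊆ CP := by
  rintro g ⟨hs, hg⟩
  refine ⟨hs, dense_iff_inter_open.2 fun U hU hne => ?_⟩
  obtain ⟨b, c, hbc, hsub⟩ := exists_Icc_subset hU hne
  by_contra hcon
  have hper : ∀ x ∈ Ioo b c, x ∉ periodicPts g := fun x hx hxp =>
    hcon ⟨x, hsub (Ioo_subset_Icc_self hx), hxp⟩
  have hrec := hg.conservative.ae_frequently_mem_of_mem_nhds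
  have hpos : μ (Ioo b c) ≠ 0 := (isOpen_Ioo.measure_pos μ (nonempty_Ioo.2 hbc)).ne'
  obtain ⟨x, hx, hrx⟩ : ∃ x ∈ Ioo b c, ∀ s ∈ 𝓝 x, ∃ᶠ n in Filter.atTop, g^[n] x ∈ s := by
    by_contra hno
    push Not at hno
    refine hpos (measure_mono_null (fun x hx => ?_) (ae_iff.1 hrec))
    obtain ⟨s, hs, hfreq⟩ := hno x hx
    exact fun hall => (hall s hs) hfreq
  obtain ⟨n, hn1, hn⟩ := Filter.frequently_atTop.1 (hrx _ (isOpen_Ioo.mem_nhds hx)) 1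
  have hsplit : ∀ m, n + 1 ≤ m → g^[m - n] (g^[n] x) = g^[m] x := fun m hm => by
    rw [← iterate_add_apply, Nat.sub_add_cancel (by omega)]
  rcases lt_trichotomy x (g^[n] x) with hlt | heq | hgt
  · obtain ⟨m, hm1, hm, hmx⟩ := Filter.frequently_atTop.1
      (hrx _ (Filter.inter_mem (isOpen_Ioo.mem_nhds hx) (isOpen_Iio.mem_nhds hlt))) (n + 1)
    rw [← hsplit m hm1] at hm hmx
    exact false_of_returns g.continuous ordConnected_Ioo hper hx hn hlt hn hm hmx
  · exact hper x hx ⟨n, hn1, heq.symm⟩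
  · obtain ⟨m, hm1, hm, hmx⟩ := Filter.frequently_atTop.1
      (hrx _ (Filter.inter_mem (isOpen_Ioo.mem_nhds hx) (isOpen_Ioi.mem_nhds hgt))) (n + 1)
    rw [← hsplit m hm1] at hm hmx
    exact false_of_returns g.continuous ordConnected_Ioo hper hn hm hmx hx hn hgt

theorem cmeas_comp {μ : Measure I} {f g : C(I, I)} (hg : g ∈ Cmeas μ) (hf : f ∈ Cmeas μ) :
    g.comp f ∈ Cmeas μ :=
  ⟨hg.1.comp hf.1, hg.2.comp hf.2⟩

/-- At every point of `(0,1)`, the images under `φ` of the two sides share an interval. -/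
def Overlaps (φ : C(I, I)) : Prop :=
  ∀ d : I, 0 < d → d < 1 → (φ '' Iic d ∩ φ '' Ici d).Nontrivial

theorem nontrivial_inter_image {χ : C(I, I)} (hχ : χ ∈ CP) {A B : Set I} (hA : A.OrdConnected)
    (hB : B.OrdConnected) (h : (A ∩ B).Nontrivial) : (χ '' A ∩ χ '' B).Nontrivial :=
  (nontrivial_image hχ (hA.inter hB) h).mono (image_inter_subset _ _ _)

theorem Overlaps.comp_left {χ φ : C(I, I)} (hφ : Overlaps φ) (hχ : χ ∈ CP) :
    Overlaps (χ.comp φ) := fun d hd0 hd1 => by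
  simp only [ContinuousMap.coe_comp, image_comp]
  exact nontrivial_inter_image hχ (ordConnected_image φ.continuous ordConnected_Iic)
    (ordConnected_image φ.continuous ordConnected_Ici) (hφ d hd0 hd1)

/-- The images `A`, `B` under `f` of the two sides of `c` cover `[0,1]` and share `f c`. Either
one of them is `[0,1]`, or they contain the two sides of `f c`, which `φ` makes overlap. -/
theorem Overlaps.comp_right {φ f : C(I, I)} (hφ : Overlaps φ) (hφ' : φ ∈ CP) (hf : f ∈ CP) :
    Overlaps (φ.comp f) := by
  intro c hc0 hc1
  simp only [ContinuousMap.coe_comp, image_comp]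
  have hAc : (f '' Iic c).OrdConnected := ordConnected_image f.continuous ordConnected_Iic
  have hBc : (f '' Ici c).OrdConnected := ordConnected_image f.continuous ordConnected_Ici
  have hA : (f '' Iic c).Nontrivial :=
    nontrivial_image hf ordConnected_Iic ⟨0, hc0.le, c, self_mem_Iic, hc0.ne⟩
  have hB : (f '' Ici c).Nontrivial :=
    nontrivial_image hf ordConnected_Ici ⟨c, self_mem_Ici, 1, hc1.le, hc1.ne⟩
  have hdA : f c ∈ f '' Iic c := ⟨c, self_mem_Iic, rfl⟩
  have hdB : f c ∈ f '' Ici c := ⟨c, self_mem_Ici, rfl⟩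
  have hcov : ∀ e, e ∈ f '' Iic c ∨ e ∈ f '' Ici c := fun e => by
    obtain ⟨x, rfl⟩ := hf.1 e
    exact (le_total x c).imp (fun h => ⟨x, h, rfl⟩) fun h => ⟨x, h, rfl⟩
  generalize f '' Iic c = A at *
  generalize f '' Ici c = B at *
  generalize f c = d at *
  -- the claim is symmetric in the two images
  have key : ∀ A B : Set I, A.OrdConnected → B.OrdConnected → A.Nontrivial → B.Nontrivial →
      d ∈ A → d ∈ B → 0 ∈ A → (1 ∈ A ∨ 1 ∈ B) → (φ '' A ∩ φ '' B).Nontrivial := by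
    intro A B hAc hBc hA hB hdA hdB h0 h1
    have hAll : ∀ C : Set I, C.OrdConnected → 0 ∈ C → 1 ∈ C → C = univ :=
      fun C hC => eq_univ_of_zero_mem_of_one_mem hC
    by_cases h1A : 1 ∈ A
    · rw [hAll A hAc h0 h1A]
      exact nontrivial_inter_image hφ' ordConnected_univ hBc (by rwa [univ_inter])
    · have h1B : 1 ∈ B := h1.resolve_left h1A
      by_cases h0B : 0 ∈ B
      · rw [hAll B hBc h0B h1B]
        exact nontrivial_inter_image hφ' hAc ordConnected_univ (by rwa [inter_univ])
      · have hd0 : 0 < d := bot_lt_iff_ne_bot.2 fun h => h0B ((show d = 0 from h) ▸ hdB)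
        have hd1 : d < 1 := lt_top_iff_ne_top.2 fun h => h1A ((show d = 1 from h) ▸ hdA)
        exact (hφ d hd0 hd1).mono (inter_subset_inter
          (image_mono fun x hx => hAc.out h0 hdA ⟨bot_le, hx⟩)
          (image_mono fun x hx => hBc.out hdB h1B ⟨hx, le_top⟩))
  rcases hcov 0 with h0 | h0
  · exact key A B hAc hBc hA hB hdA hdB h0 (hcov 1)
  · rw [inter_comm]
    exact key B A hBc hAc hB hA hdB hdA h0 (hcov 1).symm

theorem dense_leo_of_approx {X : Set C(I, I)}
    (h : ∀ f ∈ X, ∀ ε > 0, ∃ g ∈ X, (IsLeo g ∧ MovesEndpointsInside g) ∧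
      ∀ x, dist (g x) (f x) ≤ ε) :
    Dense {f : X | IsLeo f.1 ∧ MovesEndpointsInside f.1} := by
  refine Metric.dense_iff.2 fun f r hr => ?_
  obtain ⟨g, hgX, hg, hd⟩ := h f f.2 (r / 2) (by positivity)
  refine ⟨⟨g, hgX⟩, ?_, hg⟩
  exact ((ContinuousMap.dist_le (by positivity)).2 hd).trans_lt (by linarith)

/-- `μ`-preserving maps arbitrarily close to the identity, some of them overlapping at every point
of `(0,1)`, and some of them moving two prescribed points away from the endpoints. -/
structure HasPerturbations (μ : Measure I) : Prop where
  overlaps : ∀ ε > 0, ∃ φ ∈ Cmeas μ, (∀ x, dist (φ x) x ≤ ε) ∧ Overlaps φ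
  moves : ∀ ε > 0, ∀ u v, ∃ χ ∈ Cmeas μ, (∀ x, dist (χ x) x ≤ ε) ∧
    χ u ∈ Ioo (0 : I) 1 ∧ χ v ∈ Ioo (0 : I) 1

theorem HasPerturbations.dense {μ : Measure I} [IsFiniteMeasure μ] [μ.IsOpenPosMeasure]
    (h : HasPerturbations μ) :
    Dense {f : Cmeas μ | IsLeo f.1 ∧ MovesEndpointsInside f.1} := by
  refine dense_leo_of_approx fun f hf ε hε => ?_
  obtain ⟨φ, hφ, hφε, hφo⟩ := h.overlaps (ε / 2) (by positivity)
  obtain ⟨χ, hχ, hχε, hχ0, hχ1⟩ := h.moves (ε / 2) (by positivity) (φ (f 0)) (φ (f 1))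
  have hg : χ.comp (φ.comp f) ∈ Cmeas μ := cmeas_comp hχ (cmeas_comp hφ hf)
  have hsub := cmeas_subset_CP μ
  have hend : MovesEndpointsInside (χ.comp (φ.comp f)) := movesEndpointsInside_of_mem_Ioo hχ0 hχ1
  have hov := (hφo.comp_right (hsub hφ) (hsub hf)).comp_left (hsub hχ)
  refine ⟨_, hg, ⟨isLeo_of_forall_not_separates (hsub hg) hend fun c hc =>
    not_separates_of_overlap (hsub hg) (hov c hc.1 hc.2.1) hc, hend⟩, fun x => ?_⟩
  calc dist (χ (φ (f x))) (f x) ≤ dist (χ (φ (f x))) (φ (f x)) + dist (φ (f x)) (f x) :=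
        dist_triangle _ _ _
    _ ≤ ε / 2 + ε / 2 := add_le_add (hχε _) (hφε _)
    _ = ε := by ring

/-- Perturbations are transported by an increasing change of variable. -/
theorem HasPerturbations.of_orderIso {μ ν : Measure I} (h : HasPerturbations ν) (e : I ≃o I)
    (he : MeasurePreserving e μ ν) : HasPerturbations μ := by
  have hesymm : MeasurePreserving e.symm ν μ :=
    MeasurePreserving.symm e.toHomeomorph.toMeasurableEquiv he
  let conj : C(I, I) → C(I, I) := fun φ =>
    ⟨fun x => e.symm (φ (e x)), e.symm.continuous.comp (φ.continuous.comp e.continuous)⟩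
  have hconj : ∀ φ ∈ Cmeas ν, conj φ ∈ Cmeas μ := fun φ hφ =>
    ⟨e.symm.surjective.comp (hφ.1.comp e.surjective), hesymm.comp (hφ.2.comp he)⟩
  have hclose : ∀ ε > 0, ∃ δ > 0, ∀ φ : C(I, I), (∀ x, dist (φ x) x ≤ δ) →
      ∀ x, dist (conj φ x) x ≤ ε := by
    intro ε hε
    obtain ⟨δ, hδ, hu⟩ := Metric.uniformContinuous_iff.1
      (CompactSpace.uniformContinuous_of_continuous e.symm.continuous) ε hε
    refine ⟨δ / 2, by positivity, fun φ hφ x => ?_⟩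
    have := hu ((hφ (e x)).trans_lt (by linarith : δ / 2 < δ))
    rw [e.symm_apply_apply] at this
    exact this.le
  have he0 : e 0 = 0 := e.map_bot
  have he1 : e 1 = 1 := e.map_top
  have hs0 : e.symm 0 = 0 := e.symm.map_bot
  have hs1 : e.symm 1 = 1 := e.symm.map_top
  refine ⟨fun ε hε => ?_, fun ε hε u v => ?_⟩
  · obtain ⟨δ, hδ, hcl⟩ := hclose ε hε
    obtain ⟨φ, hφ, hφδ, hov⟩ := h.overlaps δ hδ
    refine ⟨conj φ, hconj φ hφ, hcl φ hφδ, fun d hd0 hd1 => ?_⟩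
    have := hov (e d) (by rw [← he0]; exact e.strictMono hd0)
      (by rw [← he1]; exact e.strictMono hd1)
    have hle : conj φ '' Iic d = e.symm '' (φ '' Iic (e d)) := by
      rw [← e.image_Iic, image_image, image_image]; rfl
    have hge : conj φ '' Ici d = e.symm '' (φ '' Ici (e d)) := by
      rw [← e.image_Ici, image_image, image_image]; rfl
    rw [hle, hge, ← image_inter e.symm.injective]
    exact this.image e.symm.injective
  · obtain ⟨δ, hδ, hcl⟩ := hclose ε hε
    obtain ⟨χ, hχ, hχδ, hu, hv⟩ := h.moves δ hδ (e u) (e v)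
    have hmem : ∀ x ∈ Ioo (0 : I) 1, e.symm x ∈ Ioo (0 : I) 1 := fun x hx =>
      ⟨by rw [← hs0]; exact e.symm.strictMono hx.1, by rw [← hs1]; exact e.symm.strictMono hx.2⟩
    exact ⟨conj χ, hconj χ hχ, hcl χ hχδ, hmem _ hu, hmem _ hv⟩

/-- The distribution function of a non-atomic probability measure with full support is an
increasing change of variable that maps it to Lebesgue measure. -/
theorem exists_orderIso_measurePreserving (μ : Measure I) [IsProbabilityMeasure μ]
    (hna : ∀ x, μ {x} = 0) [μ.IsOpenPosMeasure] :
    ∃ e : I ≃o I, MeasurePreserving e μ volume := by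
  let F : I → I := fun x => ⟨μ.real (Iic x), measureReal_nonneg, measureReal_le_one⟩
  have hF : ∀ x, (F x : ℝ) = μ.real (Iic x) := fun _ => rfl
  have hmono : StrictMono F := by
    intro x y hxy
    change μ.real (Iic x) < μ.real (Iic y)
    have hsub : Iic x ∪ Ioo x y ⊆ Iic y :=
      union_subset (Iic_subset_Iic.2 hxy.le) fun z hz => hz.2.le
    have hdisj : Disjoint (Iic x) (Ioo x y) :=
      disjoint_left.2 fun z hz hz' => absurd hz'.1 (not_lt.2 hz)
    have h1 := measureReal_mono (μ := μ) hsub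
    rw [measureReal_union hdisj measurableSet_Ioo] at h1
    have h2 : 0 < μ.real (Ioo x y) :=
      ENNReal.toReal_pos (isOpen_Ioo.measure_pos μ (nonempty_Ioo.2 hxy)).ne' (measure_ne_top _ _)
    linarith
  have hcont : Continuous F := by
    refine Continuous.subtype_mk (continuous_iff_continuousAt.2 fun x₀ => ?_) _
    have heq : (fun x => μ.real (Iic x)) = fun x => ∫ y, (Iic x).indicator (1 : I → ℝ) y ∂μ :=
      funext fun x => (integral_indicator_one measurableSet_Iic).symm
    rw [heq]
    refine continuousAt_of_dominated (bound := fun _ => 1) (.of_forall fun x =>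
      (measurable_one.indicator measurableSet_Iic).aestronglyMeasurable)
      (.of_forall fun x => .of_forall fun y => ?_) (integrable_const 1) ?_
    · by_cases h : y ∈ Iic x <;> simp [h]
    · have hne : ∀ᵐ y ∂μ, y ≠ x₀ := by
        rw [ae_iff]
        simpa using hna x₀
      filter_upwards [hne] with y hy
      rcases lt_or_gt_of_ne hy with hlt | hgt
      · refine (continuousAt_const : ContinuousAt (fun _ : I => (1 : ℝ)) x₀).congr ?_
        filter_upwards [lt_mem_nhds hlt] with x hx
        exact (indicator_of_mem (show y ∈ Iic x from le_of_lt hx) (1 : I → ℝ)).symm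
      · refine (continuousAt_const : ContinuousAt (fun _ : I => (0 : ℝ)) x₀).congr ?_
        filter_upwards [gt_mem_nhds hgt] with x hx
        exact (indicator_of_notMem (show y ∉ Iic x from not_le.2 hx) (1 : I → ℝ)).symm
  have hF0 : F 0 = 0 := by
    refine Subtype.ext ?_
    have : Iic (0 : I) = {0} := Iic_bot
    rw [hF, this, measureReal_def, hna]
    rfl
  have hF1 : F 1 = 1 := by
    refine Subtype.ext ?_
    have : Iic (1 : I) = univ := Iic_top
    rw [hF, this, probReal_univ]
    rfl
  have hsurj : Surjective F := range_eq_univ.1 <| by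
    rw [← image_univ]
    exact eq_univ_of_zero_mem_of_one_mem (ordConnected_image hcont ordConnected_univ)
      ⟨0, mem_univ _, hF0⟩ ⟨1, mem_univ _, hF1⟩
  refine ⟨hmono.orderIsoOfSurjective F hsurj, hcont.measurable, ?_⟩
  have : IsProbabilityMeasure (Measure.map (hmono.orderIsoOfSurjective F hsurj) μ) :=
    Measure.isProbabilityMeasure_map hcont.measurable.aemeasurable
  refine Measure.ext_of_Iic _ _ fun t => ?_
  obtain ⟨x, rfl⟩ := hsurj t
  rw [show Measure.map (hmono.orderIsoOfSurjective F hsurj) μ = Measure.map F μ from rfl,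
    Measure.map_apply hcont.measurable measurableSet_Iic, unitInterval.volume_Iic, hF,
    ofReal_measureReal]
  congr 1
  ext y
  exact hmono.le_iff_le

/-! ### Lebesgue measure -/

instance : (volume : Measure I).IsOpenPosMeasure where
  open_pos U hU hne h0 := by
    obtain ⟨b, c, hbc, hsub⟩ := exists_Icc_subset hU hne
    have h := measure_mono_null hsub h0
    rw [unitInterval.volume_Icc, ENNReal.ofReal_eq_zero, sub_nonpos] at h
    exact absurd hbc (not_lt.2 h)

/-- A continuous map is Lebesgue measure-preserving if the preimage of `[0,t]` has length `t`. -/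
theorem measurePreserving_of_preimage_Iic {f : I → I} (hf : Continuous f)
    (h : ∀ t < 1, volume (f ⁻¹' Iic t) = ENNReal.ofReal t) : MeasurePreserving f volume volume := by
  refine ⟨hf.measurable, ?_⟩
  have : IsProbabilityMeasure (Measure.map f volume) :=
    Measure.isProbabilityMeasure_map hf.measurable.aemeasurable
  refine Measure.ext_of_Iic _ _ fun t => ?_
  rcases lt_or_ge t 1 with ht | ht
  · rw [Measure.map_apply hf.measurable measurableSet_Iic, unitInterval.volume_Iic, h t ht]
  · have : Iic t = univ := eq_univ_of_forall fun x => le_trans le_top ht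
    rw [this, measure_univ, measure_univ]

theorem surjective_of_fixes_endpoints {f : I → I} (hf : Continuous f) (h0 : f 0 = 0)
    (h1 : f 1 = 1) : Surjective f := range_eq_univ.1 <| by
  rw [← image_univ]
  exact eq_univ_of_zero_mem_of_one_mem (ordConnected_image hf ordConnected_univ)
    ⟨0, mem_univ _, h0⟩ ⟨1, mem_univ _, h1⟩

/-! ### Zigzag maps -/

/-- The graph over `[0,1]` that rises from `0` to `1`, falls to `0` and rises to `1` again,
with slopes `±3`. -/
noncomputable def zig (t : ℝ) : ℝ := max (min (3 * t) (2 - 3 * t)) (3 * t - 2)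

/-- The map of the real line that folds each interval `[m, m + 1]` three times onto itself. -/
noncomputable def zigLine (x : ℝ) : ℝ := x + (zig (Int.fract x) - Int.fract x)

theorem zig_nonneg {t : ℝ} (h0 : 0 ≤ t) : 0 ≤ zig t := by
  unfold zig
  rcases le_total t (2 / 3) with h | h
  · exact le_max_of_le_left (le_min (by linarith) (by linarith))
  · exact le_max_of_le_right (by linarith)

theorem zig_le_one {t : ℝ} (h1 : t ≤ 1) : zig t ≤ 1 := by
  unfold zig
  refine max_le ?_ (by linarith)
  rcases le_total t (1 / 3) with h | h
  · exact (min_le_left _ _).trans (by linarith)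
  · exact (min_le_right _ _).trans (by linarith)

theorem zigLine_eq (x : ℝ) : zigLine x = ⌊x⌋ + zig (Int.fract x) := by
  unfold zigLine
  linarith [Int.floor_add_fract x]

theorem zigLine_intCast_add (j : ℤ) {r : ℝ} (h0 : 0 ≤ r) (h1 : r < 1) :
    zigLine (j + r) = j + zig r := by
  have hf : Int.fract ((j : ℝ) + r) = r := by
    rw [Int.fract_intCast_add]; exact Int.fract_eq_self.2 ⟨h0, h1⟩
  rw [zigLine, hf]; ring

theorem zigLine_intCast (j : ℤ) : zigLine j = j := by
  have := zigLine_intCast_add j le_rfl one_pos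
  simpa [zig] using this

theorem continuous_zigLine : Continuous zigLine := by
  unfold zigLine
  refine continuous_id.add ?_
  refine ContinuousOn.comp_fract'' (f := fun t : ℝ => zig t - t) ?_ (by norm_num [zig])
  unfold zig
  fun_prop

theorem zigLine_le_iff {y : ℝ} {j : ℤ} {s : ℝ} (h0 : 0 ≤ s) (h1 : s < 1) :
    zigLine y ≤ j + s ↔
      y ≤ j + s / 3 ∨ (j + (2 - s) / 3 ≤ y ∧ y ≤ j + (2 + s) / 3) := by
  have hy := Int.floor_add_fract y
  have hu0 := Int.fract_nonneg y
  have hu1 := Int.fract_lt_one y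
  rw [zigLine_eq]
  generalize Int.fract y = u at *
  rcases lt_trichotomy ⌊y⌋ j with h | h | h
  · have hj : (⌊y⌋ : ℝ) + 1 ≤ j := by exact_mod_cast h
    have := zig_le_one hu1.le
    exact ⟨fun _ => Or.inl (by linarith), fun _ => by linarith⟩
  · rw [h] at hy ⊢
    have hz : zig u ≤ s ↔ (3 * u ≤ s ∨ 2 - 3 * u ≤ s) ∧ 3 * u - 2 ≤ s := by
      rw [zig, max_le_iff, min_le_iff]
    rw [add_le_add_iff_left, hz]
    constructor
    · rintro ⟨h | h, h'⟩
      · exact Or.inl (by linarith)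
      · exact Or.inr ⟨by linarith, by linarith⟩
    · rintro (h | ⟨h, h'⟩)
      · exact ⟨Or.inl (by linarith), by linarith⟩
      · exact ⟨Or.inr (by linarith), by linarith⟩
  · have hj : (j : ℝ) + 1 ≤ ⌊y⌋ := by exact_mod_cast h
    have := zig_nonneg hu0
    refine ⟨fun _ => by linarith, ?_⟩
    rintro (h | ⟨-, h⟩) <;> linarith

theorem zigLine_nonneg {y : ℝ} (h : 0 ≤ y) : 0 ≤ zigLine y := by
  rw [zigLine_eq]
  exact add_nonneg (by exact_mod_cast Int.floor_nonneg.2 h) (zig_nonneg (Int.fract_nonneg y))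

theorem zigLine_le {y : ℝ} {n : ℕ} (h : y ≤ n) : zigLine y ≤ n := by
  rcases h.lt_or_eq with h | rfl
  · rw [zigLine_eq]
    have hfl : ⌊y⌋ < (n : ℤ) := Int.floor_lt.2 (by exact_mod_cast h)
    have hfl' : (⌊y⌋ : ℝ) + 1 ≤ n := by exact_mod_cast hfl
    linarith [zig_le_one (Int.fract_lt_one y).le]
  · exact (zigLine_intCast n).le

/-- The map of `[0,1]` that folds each of the intervals `[m / (k + 1), (m + 1) / (k + 1)]` three
times onto itself. -/
noncomputable def zigzag (k : ℕ) : C(I, I) where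
  toFun x := ⟨zigLine ((k + 1 : ℕ) * x) / (k + 1 : ℕ), by
    have hk : (0 : ℝ) < (k + 1 : ℕ) := by positivity
    refine ⟨div_nonneg (zigLine_nonneg (mul_nonneg hk.le x.2.1)) hk.le, ?_⟩
    rw [div_le_one hk]
    exact zigLine_le (mul_le_of_le_one_right hk.le x.2.2)⟩
  continuous_toFun := by
    refine Continuous.subtype_mk (Continuous.div_const ?_ _) _
    exact continuous_zigLine.comp (continuous_const.mul continuous_subtype_val)

theorem coe_zigzag (k : ℕ) (x : I) :
    (zigzag k x : ℝ) = zigLine ((k + 1 : ℕ) * x) / (k + 1 : ℕ) := rfl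

theorem zigzag_eq_self {k : ℕ} {x : I} {j : ℤ} (h : ((k + 1 : ℕ) : ℝ) * x = j) :
    zigzag k x = x := by
  refine Subtype.ext ?_
  rw [coe_zigzag, h, zigLine_intCast, ← h]
  field_simp

theorem zigzag_zero (k : ℕ) : zigzag k 0 = 0 := zigzag_eq_self (j := 0) (by simp)

theorem zigzag_one (k : ℕ) : zigzag k 1 = 1 := zigzag_eq_self (j := (k + 1 : ℕ)) (by simp)

theorem dist_zigzag_le (k : ℕ) (x : I) : dist (zigzag k x) x ≤ 1 / (k + 1 : ℕ) := by
  have hk : (0 : ℝ) < (k + 1 : ℕ) := by positivity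
  rw [Subtype.dist_eq, Real.dist_eq, coe_zigzag]
  have : zigLine ((k + 1 : ℕ) * x) / (k + 1 : ℕ) - x =
      (zig (Int.fract ((k + 1 : ℕ) * (x : ℝ))) - Int.fract ((k + 1 : ℕ) * (x : ℝ))) /
        (k + 1 : ℕ) := by
    rw [zigLine]; field_simp; ring
  rw [this, abs_div, abs_of_pos hk]
  have h0 := Int.fract_nonneg ((k + 1 : ℕ) * (x : ℝ))
  have h1 := Int.fract_lt_one ((k + 1 : ℕ) * (x : ℝ))
  have h2 := zig_nonneg h0
  have h3 := zig_le_one h1.le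
  gcongr
  rw [abs_le]
  constructor <;> linarith

theorem zigzag_mem_clambda (k : ℕ) : zigzag k ∈ Clambda := by
  refine ⟨surjective_of_fixes_endpoints (zigzag k).continuous (zigzag_zero k) (zigzag_one k),
    measurePreserving_of_preimage_Iic (zigzag k).continuous fun t ht => ?_⟩
  have hk : (0 : ℝ) < (k + 1 : ℕ) := by positivity
  have ht1 : (t : ℝ) < 1 := ht
  have hjs := Int.floor_add_fract ((k + 1 : ℕ) * (t : ℝ))
  have hs0 := Int.fract_nonneg ((k + 1 : ℕ) * (t : ℝ))
  have hs1 := Int.fract_lt_one ((k + 1 : ℕ) * (t : ℝ))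
  have hj0 : 0 ≤ ⌊(k + 1 : ℕ) * (t : ℝ)⌋ := Int.floor_nonneg.2 (mul_nonneg hk.le t.2.1)
  have hj1 : ⌊(k + 1 : ℕ) * (t : ℝ)⌋ < ((k + 1 : ℕ) : ℤ) := by
    rw [Int.floor_lt, Int.cast_natCast]
    exact mul_lt_of_lt_one_right hk ht1
  generalize ⌊(k + 1 : ℕ) * (t : ℝ)⌋ = j at *
  generalize Int.fract ((k + 1 : ℕ) * (t : ℝ)) = s at *
  have hj0' : (0 : ℝ) ≤ j := by exact_mod_cast hj0
  have hj1' : (j : ℝ) + 1 ≤ (k + 1 : ℕ) := by exact_mod_cast hj1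
  have hmem : ∀ r : ℝ, 0 ≤ r → r ≤ 1 → (j + r) / (k + 1 : ℕ) ∈ I := fun r h0 h1 =>
    ⟨by positivity, by rw [div_le_one hk]; linarith⟩
  let α : I := ⟨(j + s / 3) / (k + 1 : ℕ), hmem _ (by linarith) (by linarith)⟩
  let β : I := ⟨(j + (2 - s) / 3) / (k + 1 : ℕ), hmem _ (by linarith) (by linarith)⟩
  let γ : I := ⟨(j + (2 + s) / 3) / (k + 1 : ℕ), hmem _ (by linarith) (by linarith)⟩
  have hset : zigzag k ⁻¹' Iic t = Iic α ∪ Icc β γ := by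
    ext x
    change zigLine ((k + 1 : ℕ) * x) / (k + 1 : ℕ) ≤ t ↔
      (x : ℝ) ≤ (j + s / 3) / (k + 1 : ℕ) ∨
        ((j + (2 - s) / 3) / (k + 1 : ℕ) ≤ (x : ℝ) ∧ (x : ℝ) ≤ (j + (2 + s) / 3) / (k + 1 : ℕ))
    rw [div_le_iff₀' hk, ← hjs, zigLine_le_iff hs0 hs1, le_div_iff₀' hk, le_div_iff₀' hk,
      div_le_iff₀' hk]
  have hαβ : α < β := by
    change (j + s / 3) / (k + 1 : ℕ) < (j + (2 - s) / 3) / (k + 1 : ℕ)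
    gcongr
    linarith
  have hdisj : Disjoint (Iic α) (Icc β γ) :=
    disjoint_left.2 fun x hx hx' => absurd (hαβ.trans_le hx'.1) (not_lt.2 hx)
  rw [hset, measure_union hdisj measurableSet_Icc, unitInterval.volume_Iic,
    unitInterval.volume_Icc, ← ENNReal.ofReal_add α.2.1]
  · congr 1
    change (j + s / 3) / (k + 1 : ℕ) +
      ((j + (2 + s) / 3) / (k + 1 : ℕ) - (j + (2 - s) / 3) / (k + 1 : ℕ)) = t
    field_simp
    linarith
  · rw [sub_nonneg]
    change (j + (2 - s) / 3) / (k + 1 : ℕ) ≤ (j + (2 + s) / 3) / (k + 1 : ℕ)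
    gcongr
    linarith

/-- If `φ` fixes the endpoints and inverts the order of two points around `d`, then the images of
the two sides of `d` share an interval. -/
theorem nontrivial_inter_of_inversion {φ : C(I, I)} (h0 : φ 0 = 0) (h1 : φ 1 = 1) {x d y : I}
    (hxd : x ≤ d) (hdy : d ≤ y) (h : φ y < φ x) : (φ '' Iic d ∩ φ '' Ici d).Nontrivial := by
  have hL := (ordConnected_image φ.continuous ordConnected_Iic).out
    ⟨0, (bot_le : (0 : I) ≤ d), h0⟩ ⟨x, hxd, rfl⟩
  have hR := (ordConnected_image φ.continuous ordConnected_Ici).out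
    ⟨y, hdy, rfl⟩ ⟨1, (le_top : d ≤ 1), h1⟩
  exact ⟨φ y, ⟨hL ⟨bot_le, h.le⟩, hR ⟨le_rfl, le_top⟩⟩,
    φ x, ⟨hL ⟨bot_le, le_rfl⟩, hR ⟨h.le, le_top⟩⟩, h.ne⟩

theorem zigzag_nontrivial_inter {k : ℕ} {d : I} (hd : 0 < Int.fract ((k + 1 : ℕ) * (d : ℝ))) :
    (zigzag k '' Iic d ∩ zigzag k '' Ici d).Nontrivial := by
  have hk : (0 : ℝ) < (k + 1 : ℕ) := by positivity
  have hju := Int.floor_add_fract ((k + 1 : ℕ) * (d : ℝ))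
  have hu1 := Int.fract_lt_one ((k + 1 : ℕ) * (d : ℝ))
  have hj0 : 0 ≤ ⌊(k + 1 : ℕ) * (d : ℝ)⌋ := Int.floor_nonneg.2 (mul_nonneg hk.le d.2.1)
  have hj1 : ⌊(k + 1 : ℕ) * (d : ℝ)⌋ < ((k + 1 : ℕ) : ℤ) := by
    have : ((⌊(k + 1 : ℕ) * (d : ℝ)⌋ : ℤ) : ℝ) < ((k + 1 : ℕ) : ℝ) := by
      have := mul_le_of_le_one_right hk.le d.2.2
      linarith
    exact_mod_cast this
  generalize ⌊(k + 1 : ℕ) * (d : ℝ)⌋ = j at *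
  generalize Int.fract ((k + 1 : ℕ) * (d : ℝ)) = u at *
  have hj0' : (0 : ℝ) ≤ j := by exact_mod_cast hj0
  have hj1' : (j : ℝ) + 1 ≤ (k + 1 : ℕ) := by exact_mod_cast hj1
  have hval : ∀ r : ℝ, 0 ≤ r → r < 1 → ∃ x : I, (x : ℝ) = (j + r) / (k + 1 : ℕ) ∧
      (zigzag k x : ℝ) = (j + zig r) / (k + 1 : ℕ) := fun r h0 h1 => by
    refine ⟨⟨(j + r) / (k + 1 : ℕ), by positivity, by rw [div_le_one hk]; linarith⟩, rfl, ?_⟩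
    rw [coe_zigzag, mul_div_cancel₀ _ hk.ne', zigLine_intCast_add j h0 h1]
  have hd' : (d : ℝ) = (j + u) / (k + 1 : ℕ) := by rw [hju]; field_simp
  -- the peak of the zigzag is at `1 / 3`, its trough at `2 / 3`
  have key : ∀ r r' : ℝ, 0 ≤ r → r ≤ u → u ≤ r' → r' < 1 → zig r' < zig r →
      (zigzag k '' Iic d ∩ zigzag k '' Ici d).Nontrivial := by
    intro r r' h0 hru hur h1 hlt
    obtain ⟨x, hx, hzx⟩ := hval r h0 (by linarith)
    obtain ⟨y, hy, hzy⟩ := hval r' (by linarith) h1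
    refine nontrivial_inter_of_inversion (zigzag_zero k) (zigzag_one k) (x := x) (y := y) ?_ ?_ ?_
    · change (x : ℝ) ≤ d
      rw [hx, hd']; gcongr
    · change (d : ℝ) ≤ y
      rw [hy, hd']; gcongr
    · change (zigzag k y : ℝ) < zigzag k x
      rw [hzx, hzy]; gcongr
  have h13 : zig (1 / 3) = 1 := by norm_num [zig]
  have h23 : zig (2 / 3) = 0 := by norm_num [zig]
  rcases le_or_gt u (1 / 3) with h | h
  · refine key u (2 / 3) hd.le le_rfl (by linarith) (by norm_num) ?_
    rw [h23, zig, lt_max_iff, lt_min_iff]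
    exact Or.inl ⟨by linarith, by linarith⟩
  · rcases le_or_gt u (2 / 3) with h' | h'
    · exact key (1 / 3) (2 / 3) (by norm_num) h.le h' (by norm_num) (by rw [h13, h23]; norm_num)
    · refine key (1 / 3) u (by norm_num) h.le le_rfl hu1 ?_
      rw [h13, zig, max_lt_iff, min_lt_iff]
      exact ⟨Or.inr (by linarith), by linarith⟩

/-! ### Folding the ends -/

/-- The map that folds `[0,a]` twice onto itself, in the shape of a `V`, and fixes `[a,1]`. -/
noncomputable def endFold (a : I) : C(I, I) where
  toFun x := ⟨|2 * min (x : ℝ) a - a| + (x - min (x : ℝ) a), by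
    have hx := x.2
    have ha := a.2
    rcases le_total (x : ℝ) a with h | h
    · rw [min_eq_left h]
      refine ⟨by rw [sub_self, add_zero]; exact abs_nonneg _, ?_⟩
      have : |2 * (x : ℝ) - a| ≤ 1 := abs_le.2 ⟨by linarith [hx.1, ha.2], by linarith [ha.2]⟩
      linarith
    · rw [min_eq_right h, show 2 * (a : ℝ) - a = a by ring, abs_of_nonneg ha.1]
      exact ⟨by linarith [hx.1], by linarith [hx.2]⟩⟩
  continuous_toFun := by
    refine Continuous.subtype_mk ?_ _
    fun_prop

theorem coe_endFold_of_le {a x : I} (h : x ≤ a) : (endFold a x : ℝ) = |2 * (x : ℝ) - a| := by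
  change |2 * min (x : ℝ) a - a| + (x - min (x : ℝ) a) = _
  rw [min_eq_left (show (x : ℝ) ≤ a from h)]
  ring

theorem endFold_of_ge {a x : I} (h : a ≤ x) : endFold a x = x := by
  refine Subtype.ext ?_
  change |2 * min (x : ℝ) a - a| + (x - min (x : ℝ) a) = _
  rw [min_eq_right (show (a : ℝ) ≤ x from h), show 2 * (a : ℝ) - a = a by ring,
    abs_of_nonneg a.2.1]
  ring

theorem endFold_le_iff {a x t : I} : endFold a x ≤ t ↔
    (x ≤ a ∧ |2 * (x : ℝ) - a| ≤ t) ∨ (a ≤ x ∧ x ≤ t) := by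
  rcases lt_or_ge a x with h | h
  · rw [endFold_of_ge h.le]
    simp [h.le, h.not_ge]
  · change (endFold a x : ℝ) ≤ t ↔ _
    rw [coe_endFold_of_le h]
    refine ⟨fun h' => Or.inl ⟨h, h'⟩, ?_⟩
    rintro (⟨-, h'⟩ | ⟨h', h''⟩)
    · exact h'
    · obtain rfl := le_antisymm h h'
      have : (x : ℝ) ≤ t := h''
      rwa [show 2 * (x : ℝ) - x = x by ring, abs_of_nonneg x.2.1]

theorem dist_endFold_le (a x : I) : dist (endFold a x) x ≤ a := by
  rcases le_total x a with h | h
  · rw [Subtype.dist_eq, Real.dist_eq, coe_endFold_of_le h]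
    have hx : (x : ℝ) ≤ a := h
    have hx0 := x.2.1
    have h1 : |2 * (x : ℝ) - a| ≤ a := abs_le.2 ⟨by linarith, by linarith⟩
    have h2 := abs_nonneg (2 * (x : ℝ) - a)
    exact abs_le.2 ⟨by linarith, by linarith⟩
  · rw [endFold_of_ge h, dist_self]
    exact a.2.1

theorem endFold_ne_zero {a x : I} (ha : 0 < a) (h : 2 * (x : ℝ) ≠ a) : endFold a x ≠ 0 := by
  intro h0
  rcases le_total x a with hx | hx
  · have := coe_endFold_of_le hx
    rw [h0, eq_comm, Icc.coe_zero, abs_eq_zero, sub_eq_zero] at this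
    exact h this
  · rw [endFold_of_ge hx] at h0
    exact absurd (ha.trans_le hx) (by rw [h0]; exact lt_irrefl _)

theorem endFold_ne_one {a x : I} (ha : a < 1) (hx : x ≠ 1) : endFold a x ≠ 1 := by
  intro h1
  rcases le_total x a with h | h
  · have := coe_endFold_of_le h
    rw [h1, eq_comm, Icc.coe_one] at this
    have ha' : (a : ℝ) < 1 := ha
    have hx' : (x : ℝ) ≤ a := h
    have hx0 := x.2.1
    have : |2 * (x : ℝ) - a| < 1 := abs_lt.2 ⟨by linarith, by linarith⟩
    linarith
  · exact hx (by rwa [endFold_of_ge h] at h1)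

theorem endFold_mem_clambda (a : I) : endFold a ∈ Clambda := by
  have hmp : MeasurePreserving (endFold a) volume volume := by
    refine measurePreserving_of_preimage_Iic (endFold a).continuous fun t _ => ?_
    rcases lt_or_ge t a with h | h
    · have h' : (t : ℝ) < a := h
      have ht0 := t.2.1
      have ha1 := a.2.2
      let l : I := ⟨(a - t) / 2, by linarith, by linarith⟩
      let r : I := ⟨(a + t) / 2, by linarith, by linarith⟩
      have hset : endFold a ⁻¹' Iic t = Icc l r := by
        ext x
        rw [mem_preimage, mem_Iic, endFold_le_iff, abs_le]
        change _ ↔ (a - t : ℝ) / 2 ≤ x ∧ (x : ℝ) ≤ (a + t) / 2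
        constructor
        · rintro (⟨-, h1, h2⟩ | ⟨h1, h2⟩)
          · exact ⟨by linarith, by linarith⟩
          · exact absurd h (not_lt.2 (h1.trans h2))
        · rintro ⟨h1, h2⟩
          exact Or.inl ⟨show (x : ℝ) ≤ a by linarith, by linarith, by linarith⟩
      rw [hset, unitInterval.volume_Icc]
      congr 1
      change (a + t : ℝ) / 2 - (a - t) / 2 = t
      ring
    · have hset : endFold a ⁻¹' Iic t = Iic t := by
        ext x
        rw [mem_preimage, mem_Iic, endFold_le_iff, mem_Iic]
        constructor
        · rintro (⟨h1, -⟩ | ⟨-, h1⟩)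
          · exact h1.trans h
          · exact h1
        · intro hx
          rcases le_total x a with hxa | hxa
          · have h1 : (a : ℝ) ≤ t := h
            have h2 : (x : ℝ) ≤ a := hxa
            have hx0 := x.2.1
            exact Or.inl ⟨hxa, abs_le.2 ⟨by linarith, by linarith⟩⟩
          · exact Or.inr ⟨hxa, hx⟩
      rw [hset, unitInterval.volume_Iic]
  refine ⟨range_eq_univ.1 ?_, hmp⟩
  rw [← image_univ]
  refine eq_univ_of_zero_mem_of_one_mem
    (ordConnected_image (endFold a).continuous ordConnected_univ) ?_
    ⟨1, mem_univ _, endFold_of_ge le_top⟩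
  have ha := a.2
  let m : I := ⟨a / 2, by linarith [ha.1], by linarith [ha.2]⟩
  refine ⟨m, mem_univ _, Subtype.ext ?_⟩
  rw [coe_endFold_of_le (show (a : ℝ) / 2 ≤ a by linarith [ha.1])]
  change |2 * ((a : ℝ) / 2) - a| = 0
  rw [abs_eq_zero]
  ring

/-- Reflection of the interval, as a continuous map. -/
def reflect : C(I, I) := ⟨σ, continuous_symm⟩

theorem reflect_mem_clambda : reflect ∈ Clambda :=
  ⟨symm_bijective.surjective, measurePreserving_symm⟩

theorem dist_symm_symm (x y : I) : dist (σ x) (σ y) = dist x y := by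
  rw [Subtype.dist_eq, Subtype.dist_eq, coe_symm_eq, coe_symm_eq, Real.dist_eq, Real.dist_eq,
    abs_sub_comm]
  congr 1
  ring

theorem exists_small_ne {ε : ℝ} (hε : 0 < ε) (u v : I) :
    ∃ a : I, 0 < a ∧ a < 1 ∧ (a : ℝ) ≤ ε ∧ 2 * (u : ℝ) ≠ a ∧ 2 * (v : ℝ) ≠ a := by
  have hpos : 0 < min ε 1 := by positivity
  obtain ⟨a, ha, hne⟩ := (Ioo_infinite hpos).exists_notMem_finset {2 * (u : ℝ), 2 * (v : ℝ)}
  simp only [Finset.mem_insert, Finset.mem_singleton, not_or] at hne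
  have h1 := ha.2.trans_le (min_le_right _ _)
  exact ⟨⟨a, ha.1.le, h1.le⟩, ha.1, h1, (ha.2.trans_le (min_le_left _ _)).le,
    fun h => hne.1 h.symm, fun h => hne.2 h.symm⟩

/-- Zigzags over two grids without common interior points overlap everywhere, and folding the two
ends moves the endpoints inside; the size of the folds is chosen to avoid the given points. -/
theorem hasPerturbations_volume : HasPerturbations (volume : Measure I) := by
  refine ⟨fun ε hε => ?_, fun ε hε u v => ?_⟩
  · obtain ⟨k, hk⟩ := exists_nat_one_div_lt (show 0 < ε / 2 by positivity)
    have hsub := cmeas_subset_CP (volume : Measure I)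
    refine ⟨(zigzag (k + 1)).comp (zigzag k),
      cmeas_comp (zigzag_mem_clambda _) (zigzag_mem_clambda _), fun x => ?_, fun d hd0 hd1 => ?_⟩
    · have hk' : 1 / ((k + 1 : ℕ) : ℝ) ≤ ε / 2 := by push_cast; exact hk.le
      have hk'' : 1 / ((k + 1 + 1 : ℕ) : ℝ) ≤ 1 / ((k + 1 : ℕ) : ℝ) :=
        one_div_le_one_div_of_le (by positivity) (by push_cast; linarith)
      have h1 := dist_zigzag_le (k + 1) (zigzag k x)
      have h2 := dist_zigzag_le k x
      have h3 := dist_triangle (zigzag (k + 1) (zigzag k x)) (zigzag k x) x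
      change dist (zigzag (k + 1) (zigzag k x)) x ≤ ε
      linarith
    · simp only [ContinuousMap.coe_comp, image_comp]
      rcases (Int.fract_nonneg (((k + 1 : ℕ) : ℝ) * d)).lt_or_eq with h | h
      · exact nontrivial_inter_image (hsub (zigzag_mem_clambda _))
          (ordConnected_image (zigzag k).continuous ordConnected_Iic)
          (ordConnected_image (zigzag k).continuous ordConnected_Ici) (zigzag_nontrivial_inter h)
      · -- `d` is a point of the first grid, and so it is not one of the second
        have hint : ((k + 1 : ℕ) : ℝ) * d = ⌊((k + 1 : ℕ) : ℝ) * d⌋ := by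
          have := Int.floor_add_fract (((k + 1 : ℕ) : ℝ) * (d : ℝ))
          linarith
        have hd0' : (0 : ℝ) < d := hd0
        have hd1' : (d : ℝ) < 1 := hd1
        have hfr : 0 < Int.fract (((k + 1 + 1 : ℕ) : ℝ) * (d : ℝ)) := by
          have : ((k + 1 + 1 : ℕ) : ℝ) * (d : ℝ) = (⌊((k + 1 : ℕ) : ℝ) * (d : ℝ)⌋ : ℝ) + d := by
            rw [← hint]; push_cast; ring
          rw [this, Int.fract_intCast_add, Int.fract_eq_self.2 ⟨hd0'.le, hd1'⟩]
          exact hd0'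
        have hfix := zigzag_eq_self hint
        refine (zigzag_nontrivial_inter hfr).mono (inter_subset_inter (image_mono ?_)
          (image_mono ?_))
        · exact fun x hx => (ordConnected_image (zigzag k).continuous ordConnected_Iic).out
            ⟨0, (bot_le : (0 : I) ≤ d), zigzag_zero k⟩ ⟨d, self_mem_Iic, hfix⟩ ⟨bot_le, hx⟩
        · exact fun x hx => (ordConnected_image (zigzag k).continuous ordConnected_Ici).out
            ⟨d, self_mem_Ici, hfix⟩ ⟨1, (le_top : d ≤ 1), zigzag_one k⟩ ⟨hx, le_top⟩
  · obtain ⟨a, ha0, ha1, haε, hau, hav⟩ := exists_small_ne (show 0 < ε / 2 by positivity) u v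
    obtain ⟨b, hb0, hb1, hbε, hbu, hbv⟩ := exists_small_ne (show 0 < ε / 2 by positivity)
      (σ (endFold a u)) (σ (endFold a v))
    have hmem : ∀ x : I, 2 * (x : ℝ) ≠ a → 2 * ((σ (endFold a x) : I) : ℝ) ≠ b →
        σ (endFold b (σ (endFold a x))) ∈ Ioo (0 : I) 1 := by
      intro x hxa hxb
      refine ⟨bot_lt_iff_ne_bot.2 fun h => ?_, lt_top_iff_ne_top.2 fun h => ?_⟩
      · refine endFold_ne_one hb1 (fun h' => ?_) (symm_eq_zero.1 h)
        exact endFold_ne_zero ha0 hxa (symm_eq_one.1 h')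
      · exact endFold_ne_zero hb0 hxb (symm_eq_one.1 h)
    refine ⟨(reflect.comp ((endFold b).comp reflect)).comp (endFold a),
      cmeas_comp (cmeas_comp reflect_mem_clambda
        (cmeas_comp (endFold_mem_clambda b) reflect_mem_clambda)) (endFold_mem_clambda a),
      fun x => ?_, hmem u hau hbu, hmem v hav hbv⟩
    change dist (σ (endFold b (σ (endFold a x)))) x ≤ ε
    have h1 := dist_endFold_le a x
    have h2 := dist_endFold_le b (σ (endFold a x))
    rw [← dist_symm_symm, symm_symm] at h2
    have h3 := dist_triangle (σ (endFold b (σ (endFold a x)))) (endFold a x) x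
    linarith

/-! ### Folding the real line onto the interval -/

/-- Distance to the even integers: the map that folds the real line onto `[0,1]`, affinely of
slope `±1` between consecutive integers. -/
noncomputable def fold (x : ℝ) : ℝ := ‖(x : AddCircle (2 : ℝ))‖

theorem fold_mem (x : ℝ) : fold x ∈ I := by
  refine ⟨norm_nonneg _, ?_⟩
  have := AddCircle.norm_le_half_period (2 : ℝ) (x := (x : AddCircle (2 : ℝ))) two_ne_zero
  simpa [fold] using this

theorem fold_eq_abs_sub {x : ℝ} (m : ℤ) (h : |x - 2 * m| ≤ 1) : fold x = |x - 2 * m| := by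
  have hx : (x : AddCircle (2 : ℝ)) = ((x - 2 * m : ℝ) : AddCircle (2 : ℝ)) := by
    rw [mul_comm, ← zsmul_eq_mul, AddCircle.coe_sub, AddCircle.coe_zsmul, AddCircle.coe_period,
      smul_zero, sub_zero]
  rw [fold, hx]
  exact (AddCircle.norm_coe_eq_abs_iff (2 : ℝ) two_ne_zero).2 (by simpa using h)

theorem fold_of_mem {x : ℝ} (h : x ∈ I) : fold x = x := by
  rw [fold_eq_abs_sub 0 (by simpa [abs_of_nonneg h.1] using h.2)]
  simpa using h.1

theorem abs_fold_sub_fold_le (x y : ℝ) : |fold x - fold y| ≤ |x - y| := by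
  unfold fold
  refine (abs_norm_sub_norm_le _ _).trans ?_
  rw [← AddCircle.coe_sub]
  exact QuotientAddGroup.norm_mk_le_norm

theorem continuous_fold : Continuous fold :=
  continuous_norm.comp (AddCircle.continuous_mk' 2)

theorem fold_cases (k : ℤ) : (Even k ∧ ∀ x : ℝ, k ≤ x → x ≤ k + 1 → fold x = x - k) ∨
    (Odd k ∧ ∀ x : ℝ, k ≤ x → x ≤ k + 1 → fold x = k + 1 - x) := by
  rcases Int.even_or_odd k with h | h
  · refine Or.inl ⟨h, fun x h1 h2 => ?_⟩
    obtain ⟨m, rfl⟩ := h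
    push_cast at h1 h2 ⊢
    have : |x - 2 * m| = x - (m + m) := by rw [abs_of_nonneg (by linarith)]; ring
    rw [fold_eq_abs_sub m (by linarith), this]
  · refine Or.inr ⟨h, fun x h1 h2 => ?_⟩
    obtain ⟨m, rfl⟩ := h
    push_cast at h1 h2 ⊢
    have : |x - 2 * ((m + 1 : ℤ) : ℝ)| = 2 * m + 1 + 1 - x := by
      push_cast; rw [abs_of_nonpos (by linarith)]; ring
    rw [fold_eq_abs_sub (m + 1) (by linarith), this]

theorem abs_fold_sub_fold_eq {k : ℤ} {x y : ℝ} (hx : k ≤ x) (hx' : x ≤ k + 1) (hy : k ≤ y)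
    (hy' : y ≤ k + 1) : |fold x - fold y| = |x - y| := by
  rcases fold_cases k with ⟨-, h⟩ | ⟨-, h⟩
  · rw [h x hx hx', h y hy hy']; congr 1; ring
  · rw [h x hx hx', h y hy hy', abs_sub_comm x y]; congr 1; ring

theorem fold_even {k : ℤ} (hk : Even k) : fold k = 0 := by
  rcases fold_cases k with ⟨-, h⟩ | ⟨h, -⟩
  · rw [h k le_rfl (by linarith), sub_self]
  · exact absurd hk (Int.not_even_iff_odd.2 h)

theorem fold_odd {k : ℤ} (hk : Odd k) : fold k = 1 := by
  rcases fold_cases k with ⟨h, -⟩ | ⟨-, h⟩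
  · exact absurd h (Int.not_even_iff_odd.2 hk)
  · rw [h k le_rfl (by linarith)]; ring

theorem exists_intCast_eq_of_fold {x : ℝ} (h : fold x = 0 ∨ fold x = 1) : ∃ k : ℤ, x = k := by
  rcases fold_cases ⌊x⌋ with ⟨-, hf⟩ | ⟨-, hf⟩
  · rw [hf x (Int.floor_le x) (Int.lt_floor_add_one x).le] at h
    rcases h with h | h
    · exact ⟨⌊x⌋, by linarith⟩
    · exact ⟨⌊x⌋ + 1, by push_cast; linarith⟩
  · rw [hf x (Int.floor_le x) (Int.lt_floor_add_one x).le] at h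
    rcases h with h | h
    · exact ⟨⌊x⌋ + 1, by push_cast; linarith⟩
    · exact ⟨⌊x⌋, by linarith⟩

/-- An interval of length at most one contains a subinterval of at least half its length on which
`fold` is an isometry. -/
theorem exists_subinterval_between_integers {a b : ℝ} (hab : a ≤ b) (h1 : b ≤ a + 1) :
    ∃ (k : ℤ) (a' b' : ℝ), a ≤ a' ∧ a' ≤ b' ∧ b' ≤ b ∧ k ≤ a' ∧ b' ≤ k + 1 ∧
      (b - a) / 2 ≤ b' - a' := by
  have hfl := Int.floor_le b
  have hfl' := Int.lt_floor_add_one b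
  rcases le_or_gt (⌊b⌋ : ℝ) a with h | h
  · exact ⟨⌊b⌋, a, b, le_rfl, hab, le_rfl, h, hfl'.le, by linarith⟩
  · rcases le_total (b - ⌊b⌋) (⌊b⌋ - a) with h' | h'
    · exact ⟨⌊b⌋ - 1, a, ⌊b⌋, le_rfl, h.le, hfl, by push_cast; linarith, by push_cast; linarith,
        by linarith⟩
    · exact ⟨⌊b⌋, ⌊b⌋, b, h.le, hfl, le_rfl, le_rfl, hfl'.le, by linarith⟩

theorem exists_fold_expands {G : I → ℝ} (hG : Continuous G) (u v : I) :
    ∃ x ∈ uIcc u v, ∃ y ∈ uIcc u v,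
      min |G u - G v| 1 / 2 ≤ |fold (G x) - fold (G y)| := by
  have habs : |G u - G v| = max (G u) (G v) - min (G u) (G v) := by
    rw [max_sub_min_eq_abs, abs_sub_comm]
  set α := min (G u) (G v)
  have hα : α ≤ max (G u) (G v) := min_le_max
  have hLnn := abs_nonneg (G u - G v)
  obtain ⟨k, a', b', h1, h2, h3, h4, h5, h6⟩ :=
    exists_subinterval_between_integers (a := α) (b := α + min |G u - G v| 1)
      (by linarith [le_min hLnn zero_le_one]) (by linarith [min_le_right |G u - G v| 1])
  have hb : b' ≤ max (G u) (G v) := by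
    have := min_le_left |G u - G v| 1
    linarith
  have himg := intermediate_value_uIcc (a := u) (b := v) hG.continuousOn
  obtain ⟨x, hx, rfl⟩ := himg (show a' ∈ _ from ⟨h1, h2.trans hb⟩)
  obtain ⟨y, hy, rfl⟩ := himg (show b' ∈ _ from ⟨h1.trans h2, hb⟩)
  refine ⟨x, hx, y, hy, ?_⟩
  rw [abs_fold_sub_fold_eq h4 (h2.trans h5) (h4.trans h2) h5, abs_sub_comm (G x),
    abs_of_nonneg (sub_nonneg.2 h2)]
  linarith

/-! ### Leo maps near maps with dense periodic points -/

theorem IsLeo.surjective {g : C(I, I)} (hg : IsLeo g) : Surjective g := by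
  obtain ⟨n, hn⟩ := hg (Ioi 0) isOpen_Ioi ⟨1, mem_Ioi.2 zero_lt_one⟩
  have hn0 : n ≠ 0 := by
    rintro rfl
    rw [iterate_zero, image_id] at hn
    exact lt_irrefl (0 : I) (hn.symm ▸ mem_univ (0 : I) : (0 : I) ∈ Ioi 0)
  obtain ⟨n, rfl⟩ := Nat.exists_eq_succ_of_ne_zero hn0
  intro y
  obtain ⟨x, -, hx⟩ := hn.symm ▸ mem_univ y
  exact ⟨g^[n] x, by rwa [iterate_succ_apply'] at hx⟩

theorem IsLeo.mem_CP {g : C(I, I)} (hg : IsLeo g) : g ∈ CP := by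
  refine ⟨hg.surjective, dense_iff_inter_open.2 fun U hU hne => ?_⟩
  obtain ⟨b, c, hbc, hsub⟩ := exists_Icc_subset hU hne
  obtain ⟨n, hn⟩ := hg (Ioo b c) isOpen_Ioo (nonempty_Ioo.2 hbc)
  have hn' := image_iterate_eq_univ_of_le hg.surjective (Nat.le_succ n) hn
  have hcov : g^[n + 1] '' Icc b c = univ :=
    eq_univ_of_univ_subset (hn' ▸ image_mono Ioo_subset_Icc_self)
  obtain ⟨z, hz, hfix⟩ := exists_fixedPt_of_subset_image (g.continuous.iterate (n + 1))
    (S := Icc b c) ordConnected_Icc (left_mem_Icc.2 hbc.le) (right_mem_Icc.2 hbc.le) Subset.rfl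
    (hcov ▸ subset_univ _)
  exact ⟨z, hsub hz, n + 1, n.succ_pos, hfix⟩

/-- The `k`-th of the `M` intervals of length `1 / M` into which `[0,1]` is divided. -/
def block (M k : ℕ) : Set I := {x | (k : ℝ) ≤ M * x ∧ M * (x : ℝ) ≤ k + 1}

theorem exists_mem_block {M : ℕ} (hM : 0 < M) (x : I) : ∃ k < M, x ∈ block M k := by
  have hM' : (0 : ℝ) < M := by exact_mod_cast hM
  have hnn : (0 : ℝ) ≤ M * x := mul_nonneg hM'.le x.2.1
  have hle : (M : ℝ) * x ≤ M := mul_le_of_le_one_right hM'.le x.2.2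
  rcases hle.lt_or_eq with h | h
  · exact ⟨⌊(M : ℝ) * x⌋₊, (Nat.floor_lt hnn).2 h, Nat.floor_le hnn, (Nat.lt_floor_add_one _).le⟩
  · have hcast : ((M - 1 : ℕ) : ℝ) = M - 1 := by rw [Nat.cast_sub hM]; simp
    exact ⟨M - 1, by omega, by rw [hcast]; linarith, by rw [hcast]; linarith⟩

theorem dist_le_of_mem_block {M j k : ℕ} (hM : 0 < M) (h1 : j ≤ k + 1) (h2 : k ≤ j + 1) {x y : I}
    (hx : x ∈ block M j) (hy : y ∈ block M k) : dist x y ≤ 2 / M := by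
  have hM' : (0 : ℝ) < M := by exact_mod_cast hM
  have h1' : (j : ℝ) ≤ k + 1 := by exact_mod_cast h1
  have h2' : (k : ℝ) ≤ j + 1 := by exact_mod_cast h2
  rw [Subtype.dist_eq, Real.dist_eq, le_div_iff₀ hM', ← abs_of_pos hM', ← abs_mul, abs_le]
  constructor <;> nlinarith [hx.1, hx.2, hy.1, hy.2]

theorem block_subset {M : ℕ} (hM : 0 < M) {S : Set I} (hS : S.OrdConnected) {u v : I}
    (hu : u ∈ S) (hv : v ∈ S) (h : 2 / (M : ℝ) ≤ dist u v) : ∃ k < M, block M k ⊆ S := by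
  have hM' : (0 : ℝ) < M := by exact_mod_cast hM
  have key : ∀ u ∈ S, ∀ v ∈ S, u ≤ v → 2 / (M : ℝ) ≤ dist u v → ∃ k < M, block M k ⊆ S := by
    intro u hu v hv huv h
    have huv' : (u : ℝ) ≤ v := huv
    rw [Subtype.dist_eq, Real.dist_eq, abs_sub_comm, abs_of_nonneg (by linarith),
      div_le_iff₀ hM'] at h
    have hnn : (0 : ℝ) ≤ M * u := mul_nonneg hM'.le u.2.1
    have h1 := Nat.le_ceil ((M : ℝ) * u)
    have h2 := Nat.ceil_lt_add_one hnn
    have h3 : (M : ℝ) * v ≤ M := mul_le_of_le_one_right hM'.le v.2.2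
    refine ⟨⌈(M : ℝ) * u⌉₊, ?_, fun x hx => hS.out hu hv ⟨?_, ?_⟩⟩
    · have : (⌈(M : ℝ) * u⌉₊ : ℝ) < M := by linarith
      exact_mod_cast this
    · change (u : ℝ) ≤ x
      exact le_of_mul_le_mul_left (h1.trans hx.1) hM'
    · change (x : ℝ) ≤ v
      refine le_of_mul_le_mul_left (hx.2.trans ?_) hM'
      linarith
  rcases le_total u v with huv | huv
  · exact key u hu v hv huv h
  · exact key v hv u hu huv (by rwa [dist_comm])

/-- If `g` stretches short distances by a factor two, every interval eventually grows to contain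
a block. -/
theorem exists_block_subset_image {g : C(I, I)} {M : ℕ} (hM : 0 < M)
    (hexp : ∀ u v : I, ∃ x ∈ uIcc u v, ∃ y ∈ uIcc u v,
      min (2 * dist u v) (2 / M) ≤ dist (g x) (g y))
    {S : Set I} (hS : S.OrdConnected) {u v : I} (hu : u ∈ S) (hv : v ∈ S) (huv : u ≠ v) :
    ∃ n, ∃ k < M, block M k ⊆ g^[n] '' S := by
  have hM' : (0 : ℝ) < M := by exact_mod_cast hM
  have hgrow : ∀ n : ℕ, ∃ x ∈ g^[n] '' S, ∃ y ∈ g^[n] '' S,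
      min (2 ^ n * dist u v) (2 / M) ≤ dist x y := by
    intro n
    induction n with
    | zero => exact ⟨u, ⟨u, hu, rfl⟩, v, ⟨v, hv, rfl⟩, by simp⟩
    | succ n ih =>
      obtain ⟨x, hx, y, hy, hxy⟩ := ih
      obtain ⟨x', hx', y', hy', h⟩ := hexp x y
      have hsub := (ordConnected_image (g.continuous.iterate n) hS).uIcc_subset hx hy
      rw [iterate_succ', image_comp]
      refine ⟨g x', ⟨x', hsub hx', rfl⟩, g y', ⟨y', hsub hy', rfl⟩, le_trans ?_ h⟩
      refine le_min ?_ (min_le_right _ _)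
      rcases le_total (2 ^ n * dist u v) (2 / (M : ℝ)) with h' | h'
      · rw [min_eq_left h'] at hxy
        refine (min_le_left _ _).trans ?_
        rw [pow_succ]; linarith
      · rw [min_eq_right h'] at hxy
        refine (min_le_right _ _).trans ?_
        have : (0 : ℝ) < 2 / M := by positivity
        linarith
  obtain ⟨n, hn⟩ := pow_unbounded_of_one_lt (2 / M / dist u v) (one_lt_two (α := ℝ))
  rw [div_lt_iff₀ (dist_pos.2 huv)] at hn
  obtain ⟨x, hx, y, hy, hxy⟩ := hgrow n
  rw [min_eq_right hn.le] at hxy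
  exact ⟨n, block_subset hM (ordConnected_image (g.continuous.iterate n) hS) hx hy hxy⟩

/-- Suppose that `f` has dense periodic points and that `g` maps every block onto a neighbourhood
of the `f`-images of its points. Following a periodic orbit of `f` through a block, one sees that
an iterate of `g` maps the block over itself and its neighbours; hence a further iterate maps it
onto `[0,1]`. -/
theorem exists_image_block_eq_univ {f g : C(I, I)} (hf : f ∈ CP) {M : ℕ} (hM : 0 < M)
    (hcov : ∀ k < M, ∀ x ∈ block M k, ∀ y, dist y (f x) ≤ 2 / M → y ∈ g '' block M k) :
    ∃ n, ∀ k < M, g^[n] '' block M k = univ := by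
  have hM' : (0 : ℝ) < M := by exact_mod_cast hM
  have hfollow : ∀ k < M, ∀ x ∈ block M k, ∀ n : ℕ, ∀ y, dist y (f^[n + 1] x) ≤ 2 / M →
      y ∈ g^[n + 1] '' block M k := by
    intro k hk x hx n
    induction n with
    | zero => exact hcov k hk x hx
    | succ n ih =>
      intro y hy
      obtain ⟨j, hj, hxj⟩ := exists_mem_block hM (f^[n + 1] x)
      rw [iterate_succ_apply'] at hy
      obtain ⟨z, hz, rfl⟩ := hcov j hj _ hxj y hy
      obtain ⟨w, hw, hwz⟩ := ih z (dist_le_of_mem_block hM (by omega) (by omega) hz hxj)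
      exact ⟨w, hw, by rw [iterate_succ_apply', hwz]⟩
  have hper : ∀ k : ℕ, ∃ N, 0 < N ∧ (k < M → ∀ j, j ≤ k + 1 → k ≤ j + 1 →
      block M j ⊆ g^[N] '' block M k) := by
    intro k
    by_cases hk : k < M
    · have hk' : (k : ℝ) + 1 ≤ M := by exact_mod_cast hk
      let c : I := ⟨k / M, by positivity, by rw [div_le_one hM']; linarith⟩
      let c' : I := ⟨(k + 1) / M, by positivity, by rw [div_le_one hM']; linarith⟩
      have hcc : c < c' := by
        change (k : ℝ) / M < (k + 1) / M
        gcongr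
        linarith
      obtain ⟨p, ⟨N, hN, hpN⟩, hcp, hpc⟩ := hf.2.exists_between hcc
      have h1 : (k : ℝ) / M < p := hcp
      have h2 : (p : ℝ) < (k + 1) / M := hpc
      rw [div_lt_iff₀' hM'] at h1
      rw [lt_div_iff₀' hM'] at h2
      refine ⟨N, hN, fun _ j hj1 hj2 y hy => ?_⟩
      have := hfollow k hk p ⟨h1.le, h2.le⟩ (N - 1) y
      rw [Nat.sub_add_cancel hN, hpN.eq] at this
      exact this (dist_le_of_mem_block hM hj1 hj2 hy ⟨h1.le, h2.le⟩)
    · exact ⟨1, one_pos, fun h => absurd h hk⟩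
  choose N hN hNb using hper
  -- a common multiple of the periods
  set Q := ∏ k ∈ Finset.range M, N k
  have hQ : ∀ k < M, ∀ j, j ≤ k + 1 → k ≤ j + 1 → block M j ⊆ g^[Q] '' block M k := by
    intro k hk j hj1 hj2
    obtain ⟨m, hm⟩ : N k ∣ Q := Finset.dvd_prod_of_mem N (Finset.mem_range.2 hk)
    have hQ0 : 0 < Q := Finset.prod_pos fun k _ => hN k
    have hself : ∀ l, block M k ⊆ g^[N k * l] '' block M k := by
      intro l
      induction l with
      | zero => simp
      | succ l ih =>
        rw [Nat.mul_succ, iterate_add, image_comp]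
        exact ih.trans (image_mono (hNb k hk k (by omega) (by omega)))
    obtain ⟨l, rfl⟩ : ∃ l, m = l + 1 :=
      Nat.exists_eq_succ_of_ne_zero (by rintro rfl; rw [hm] at hQ0; simp at hQ0)
    rw [hm, mul_comm, Nat.succ_mul, add_comm, iterate_add, image_comp]
    refine (hNb k hk j hj1 hj2).trans (image_mono ?_)
    rw [mul_comm]
    exact hself l
  have hspread : ∀ k < M, ∀ m j : ℕ, j < M → j ≤ k + m → k ≤ j + m →
      block M j ⊆ g^[Q * m] '' block M k := by
    intro k hk m
    induction m with
    | zero =>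
      intro j _ h1 h2
      obtain rfl : j = k := by omega
      simp
    | succ m ih =>
      intro j hj h1 h2
      obtain ⟨i, hi, hi1, hi2, hij, hji⟩ : ∃ i < M, i ≤ k + m ∧ k ≤ i + m ∧ j ≤ i + 1 ∧
          i ≤ j + 1 := by
        rcases lt_or_ge (k + m) j with h | h
        · exact ⟨j - 1, by omega, by omega, by omega, by omega, by omega⟩
        · rcases lt_or_ge (j + m) k with h' | h'
          · exact ⟨j + 1, by omega, by omega, by omega, by omega, by omega⟩
          · exact ⟨j, by omega, by omega, by omega, by omega, by omega⟩
      rw [Nat.mul_succ, add_comm, iterate_add, image_comp]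
      exact (hQ i hi j hij hji).trans (image_mono (ih i hi hi1 hi2))
  refine ⟨Q * M, fun k hk => eq_univ_of_forall fun x => ?_⟩
  obtain ⟨j, hj, hx⟩ := exists_mem_block hM x
  exact hspread k hk M j hj (by omega) (by omega) hx

/-- The function `F` with an oscillation of total height `η` added to it, which is monotone on each
of the `M` blocks, folded back into `[0,1]`. -/
noncomputable def oscillate (F : ℝ → ℝ) (hF : Continuous F) (η : ℝ) (M : ℕ) : C(I, I) where
  toFun x := ⟨fold (F x + η * (fold (M * x) - 1 / 2)), fold_mem _⟩
  continuous_toFun := by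
    refine Continuous.subtype_mk (continuous_fold.comp ?_) _
    have := continuous_fold
    fun_prop

/-- If the oscillations are much steeper than `F`, they stretch short distances. -/
theorem oscillate_expands {F : ℝ → ℝ} (hF : Continuous F) {η K : ℝ} {M : ℕ} (hη : 0 < η)
    (hlip : ∀ x y : I, |F x - F y| ≤ K * |(x : ℝ) - y|) (hM : 4 ≤ M)
    (hsteep : 8 + K ≤ η * M) (u v : I) :
    ∃ x ∈ uIcc u v, ∃ y ∈ uIcc u v,
      min (2 * dist u v) (2 / M) ≤ dist (oscillate F hF η M x) (oscillate F hF η M y) := by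
  have hM4 : (4 : ℝ) ≤ M := by exact_mod_cast hM
  have hM' : (0 : ℝ) < M := by linarith
  have key : ∀ u v : I, u ≤ v → ∃ x ∈ uIcc u v, ∃ y ∈ uIcc u v,
      min (2 * dist u v) (2 / M) ≤ dist (oscillate F hF η M x) (oscillate F hF η M y) := by
    intro u v huv
    have huv' : (u : ℝ) ≤ v := huv
    have hd : dist u v = v - u := by
      rw [Subtype.dist_eq, Real.dist_eq, abs_sub_comm, abs_of_nonneg (by linarith)]
    rw [hd]
    -- shorten the interval to length at most `1 / M`, so that the oscillation turns at most once
    have hlen : 0 ≤ min ((M : ℝ) * (v - u)) 1 := le_min (by nlinarith) zero_le_one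
    obtain ⟨k, a, b, h1, h2, h3, h4, h5, h6⟩ := exists_subinterval_between_integers
      (a := M * u) (b := M * u + min ((M : ℝ) * ((v : ℝ) - u)) 1) (by linarith)
      (by linarith [min_le_right ((M : ℝ) * (v - u)) 1])
    set t := min ((M : ℝ) * (v - u)) 1
    have hb : b ≤ M * v := by
      have := min_le_left ((M : ℝ) * (v - u)) 1
      linarith
    have hau : (u : ℝ) ≤ a / M := by rw [le_div_iff₀' hM']; exact h1
    have hab : a / M ≤ b / M := by gcongr
    have hbv : b / M ≤ v := by rw [div_le_iff₀' hM']; exact hb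
    let x : I := ⟨a / M, by linarith [u.2.1], by linarith [v.2.2]⟩
    let y : I := ⟨b / M, by linarith [u.2.1], by linarith [v.2.2]⟩
    have hxuv : x ∈ uIcc u v := mem_uIcc.2 (Or.inl ⟨hau, hab.trans hbv⟩)
    have hyuv : y ∈ uIcc u v := mem_uIcc.2 (Or.inl ⟨hau.trans hab, hbv⟩)
    let G : I → ℝ := fun x => F x + η * (fold (M * x) - 1 / 2)
    have hG : Continuous G := by
      have := continuous_fold
      fun_prop
    have hMx : (M : ℝ) * x = a := mul_div_cancel₀ _ hM'.ne'
    have hMy : (M : ℝ) * y = b := mul_div_cancel₀ _ hM'.ne'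
    have hfold : |fold (M * x) - fold (M * y)| = b - a := by
      rw [hMx, hMy, abs_fold_sub_fold_eq h4 (h2.trans h5) (h4.trans h2) h5, abs_sub_comm,
        abs_of_nonneg (by linarith)]
    have hxy : |(x : ℝ) - y| = (b - a) / M := by
      rw [abs_sub_comm, abs_of_nonneg (by change 0 ≤ b / M - a / M; linarith)]
      change b / M - a / M = _
      ring
    have hGxy : 4 * (t / M) ≤ |G x - G y| := by
      have e : η * (fold (M * x) - fold (M * y)) = (G x - G y) - (F x - F y) := by
        simp only [G]; ring
      have hle : η * (b - a) ≤ |G x - G y| + K * ((b - a) / M) := by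
        calc η * (b - a) = |η * (fold (M * x) - fold (M * y))| := by
              rw [abs_mul, hfold, abs_of_pos hη]
          _ ≤ |G x - G y| + |F x - F y| := by rw [e]; exact abs_sub _ _
          _ ≤ _ := by rw [← hxy]; linarith [hlip x y]
      have hs : (8 : ℝ) ≤ η * M - K := by linarith
      have : 4 * (t / M) ≤ (η * M - K) * ((b - a) / M) := by
        have hba : t / 2 ≤ b - a := by linarith
        calc 4 * (t / M) = 8 * (t / 2 / M) := by ring
          _ ≤ (η * M - K) * ((b - a) / M) := by gcongr
      have e2 : (η * M - K) * ((b - a) / M) = η * (b - a) - K * ((b - a) / M) := by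
        field_simp
      linarith
    obtain ⟨x', hx', y', hy', hdist⟩ := exists_fold_expands hG x y
    have hsub : uIcc x y ⊆ uIcc u v := uIcc_subset_uIcc hxuv hyuv
    refine ⟨x', hsub hx', y', hsub hy', le_trans ?_ hdist⟩
    have h2M : 2 / (M : ℝ) ≤ 1 / 2 := by rw [div_le_div_iff₀ hM' two_pos]; linarith
    rcases le_total |G x - G y| 1 with hG1 | hG1
    · rw [min_eq_left hG1]
      have ht : min (2 * ((v : ℝ) - u)) (2 / M) = 2 * (t / M) := by
        rcases le_total ((M : ℝ) * (v - u)) 1 with hc | hc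
        · have : t = M * (v - u) := min_eq_left hc
          rw [this, mul_div_cancel_left₀ _ hM'.ne', min_eq_left]
          rw [le_div_iff₀ hM']
          linarith
        · have : t = 1 := min_eq_right hc
          rw [this, min_eq_right]
          · ring
          · rw [div_le_iff₀ hM']
            linarith
      linarith
    · rw [min_eq_right hG1]
      exact (min_le_right _ _).trans h2M
  rcases le_total u v with h | h
  · exact key u v h
  · rw [uIcc_comm, dist_comm]
    exact key v u h

/-- If the oscillation outweighs the error `γ` of the approximation `F` of `f` and the variation of
`F` on a block, then the image of a block contains a neighbourhood of the `f`-image of each of its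
points. -/
theorem mem_image_oscillate {f : C(I, I)} {F : ℝ → ℝ} (hF : Continuous F) {η K γ : ℝ} {M : ℕ}
    (hK : 0 ≤ K) (hlip : ∀ x y : I, |F x - F y| ≤ K * |(x : ℝ) - y|)
    (happrox : ∀ x : I, |F x - f x| ≤ γ) (hM : 0 < M) (hamp : 2 / M + γ + K / M ≤ η / 2)
    {k : ℕ} (hk : k < M) {x : I} (hx : x ∈ block M k) {y : I} (hy : dist y (f x) ≤ 2 / M) :
    y ∈ oscillate F hF η M '' block M k := by
  have hM' : (0 : ℝ) < M := by exact_mod_cast hM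
  have hk' : (k : ℝ) + 1 ≤ M := by exact_mod_cast hk
  let G : I → ℝ := fun x => F x + η * (fold (M * x) - 1 / 2)
  have hG : Continuous G := by
    have := continuous_fold
    fun_prop
  -- at one end of the block the oscillation is at its bottom, at the other end at its top
  have hend : ∀ l : ℕ, l = k ∨ l = k + 1 → ∃ e ∈ block M k, (M : ℝ) * e = l := by
    intro l hl
    have hlM : (l : ℝ) ≤ M := by
      rcases hl with rfl | rfl
      · linarith
      · exact_mod_cast hk'
    have he : (M : ℝ) * (l / M) = l := mul_div_cancel₀ _ hM'.ne'
    refine ⟨⟨l / M, by positivity, by rw [div_le_one hM']; exact hlM⟩, ?_, he⟩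
    change (k : ℝ) ≤ M * (l / M) ∧ (M : ℝ) * (l / M) ≤ k + 1
    rw [he]
    rcases hl with rfl | rfl <;> push_cast <;> constructor <;> linarith
  obtain ⟨e0, he0, hfe0, e1, he1, hfe1⟩ : ∃ e0 ∈ block M k, fold (M * e0) = 0 ∧
      ∃ e1 ∈ block M k, fold (M * e1) = 1 := by
    obtain ⟨a, ha, hMa⟩ := hend k (Or.inl rfl)
    obtain ⟨b, hb, hMb⟩ := hend (k + 1) (Or.inr rfl)
    have hMa' : (M : ℝ) * a = ((k : ℤ) : ℝ) := by rw [hMa]; simp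
    have hMb' : (M : ℝ) * b = (((k : ℤ) + 1 : ℤ) : ℝ) := by rw [hMb]; push_cast; rfl
    rcases Int.even_or_odd (k : ℤ) with h | h
    · exact ⟨a, ha, by rw [hMa', fold_even h], b, hb, by rw [hMb', fold_odd h.add_one]⟩
    · exact ⟨b, hb, by rw [hMb', fold_even h.add_one], a, ha, by rw [hMa', fold_odd h]⟩
  have hnear : ∀ e ∈ block M k, |F e - f x| ≤ γ + K / M := by
    intro e he
    have h1 : |(e : ℝ) - x| ≤ 1 / M := by
      rw [le_div_iff₀ hM', ← abs_of_pos hM', ← abs_mul, abs_le]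
      constructor <;> nlinarith [hx.1, hx.2, he.1, he.2]
    calc |F e - f x| ≤ |F e - F x| + |F x - f x| := abs_sub_le _ _ _
      _ ≤ K * (1 / M) + γ := by
          have := mul_le_mul_of_nonneg_left h1 hK
          linarith [hlip e x, happrox x]
      _ = γ + K / M := by ring
  rw [Subtype.dist_eq, Real.dist_eq, abs_le] at hy
  have hn0 := abs_le.1 (hnear e0 he0)
  have hn1 := abs_le.1 (hnear e1 he1)
  have hG0 : G e0 ≤ y := by simp only [G]; rw [hfe0]; linarith
  have hG1 : (y : ℝ) ≤ G e1 := by simp only [G]; rw [hfe1]; linarith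
  obtain ⟨z, hz, hzy⟩ := intermediate_value_uIcc (a := e0) (b := e1) hG.continuousOn
    (show (y : ℝ) ∈ _ from mem_uIcc.2 (Or.inl ⟨hG0, hG1⟩))
  have hconn : (block M k).OrdConnected := ⟨fun p hp q hq r hr => by
    have h1 : (p : ℝ) ≤ r := hr.1
    have h2 : (r : ℝ) ≤ q := hr.2
    exact ⟨hp.1.trans (by gcongr), le_trans (by gcongr) hq.2⟩⟩
  refine ⟨z, hconn.uIcc_subset he0 he1 hz, Subtype.ext ?_⟩
  change fold (G z) = y
  rw [hzy, fold_of_mem y.2]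

theorem exists_lipschitz_approx (f : C(I, I)) {γ : ℝ} (hγ : 0 < γ) :
    ∃ F : ℝ → ℝ, Continuous F ∧ (∀ x : I, |F x - f x| ≤ γ) ∧
      ∃ K : ℝ, 0 ≤ K ∧ ∀ x y : I, |F x - F y| ≤ K * |(x : ℝ) - y| := by
  obtain ⟨p, hp⟩ := exists_polynomial_near_of_continuousOn 0 1
    (fun x => (f (projIcc 0 1 zero_le_one x) : ℝ))
    ((continuous_subtype_val.comp (f.continuous.comp continuous_projIcc)).continuousOn) γ hγ
  have hlip : LocallyLipschitz fun x : ℝ => p.eval x := by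
    have : ContDiff ℝ 1 fun x : ℝ => p.eval x := by
      simpa using p.contDiff_aeval (𝕜 := ℝ) (n := 1)
    exact this.locallyLipschitz
  obtain ⟨K, hK⟩ := hlip.locallyLipschitzOn (s := I) |>.exists_lipschitzOnWith_of_compact
    isCompact_Icc
  refine ⟨fun x => p.eval x, p.continuous, fun x => ?_, K, K.2, fun x y => ?_⟩
  · have := hp x x.2
    rw [projIcc_val] at this
    exact this.le
  · have := hK.dist_le_mul x x.2 y y.2
    rwa [Real.dist_eq, Real.dist_eq] at this

/-- A map with dense periodic points is a uniform limit of leo maps that move the endpoints inside: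
let a Lipschitz approximation of it oscillate rapidly. -/
theorem exists_leo_near {f : C(I, I)} (hf : f ∈ CP) {ε : ℝ} (hε : 0 < ε) :
    ∃ g : C(I, I), (IsLeo g ∧ MovesEndpointsInside g) ∧ ∀ x, dist (g x) (f x) ≤ ε := by
  obtain ⟨F, hF, happrox, K, hK, hlip⟩ := exists_lipschitz_approx f (show 0 < ε / 8 by positivity)
  -- a generic amplitude, so that the endpoints are not mapped to endpoints
  obtain ⟨η, hη, hgen⟩ : ∃ η ∈ Ioo (ε / 2) ε,
      η ∉ range (fun k : ℤ => 2 * (F 0 - k)) ∪ range (fun k : ℤ => 2 * (F 1 - k)) := by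
    have hcount : (range (fun k : ℤ => 2 * (F 0 - k)) ∪
        range (fun k : ℤ => 2 * (F 1 - k))).Countable :=
      (countable_range _).union (countable_range _)
    by_contra hcon
    push Not at hcon
    exact Cardinal.Real.Ioo_countable_iff.not.2 (by linarith) (hcount.mono hcon)
  rw [mem_union, not_or] at hgen
  have hη0 : 0 < η := by linarith [hη.1]
  obtain ⟨m, hm⟩ := exists_nat_ge (8 * (K + 8) / ε + 4)
  set M := 2 * m
  have hMm : (M : ℝ) = 2 * m := by simp [M]
  have hM4 : (4 : ℝ) ≤ m := by
    have : 0 ≤ 8 * (K + 8) / ε := by positivity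
    linarith
  have hM' : (0 : ℝ) < M := by linarith
  have hM : 0 < M := by exact_mod_cast hM'
  have hMbig : 8 * (K + 8) ≤ ε * M := by
    have : 8 * (K + 8) / ε ≤ M := by linarith
    rwa [div_le_iff₀' hε] at this
  have hMeven : Even (M : ℤ) := ⟨m, by simp [M]; ring⟩
  have hexp := oscillate_expands hF hη0 hlip (M := M)
    (by have : (4 : ℝ) ≤ M := by linarith
        exact_mod_cast this)
    (by nlinarith [hη.1])
  have hamp : 2 / M + ε / 8 + K / M ≤ η / 2 := by
    have : 2 / M + K / M ≤ ε / 8 := by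
      rw [← add_div, div_le_iff₀ hM']
      linarith
    linarith [hη.1]
  obtain ⟨n, hn⟩ := exists_image_block_eq_univ hf hM (g := oscillate F hF η M)
    fun k hk x hx y hy => mem_image_oscillate hF hK hlip happrox hM hamp hk hx hy
  refine ⟨oscillate F hF η M, ⟨fun U hU hne => ?_, ?_⟩, fun x => ?_⟩
  · obtain ⟨b, c, hbc, hsub⟩ := exists_Icc_subset hU hne
    obtain ⟨l, k, hk, hblock⟩ := exists_block_subset_image hM hexp ordConnected_Icc
      (left_mem_Icc.2 hbc.le) (right_mem_Icc.2 hbc.le) hbc.ne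
    refine ⟨n + l, eq_univ_of_univ_subset ?_⟩
    rw [← hn k hk, iterate_add, image_comp]
    exact image_mono (hblock.trans (image_mono hsub))
  · have h0 : ((oscillate F hF η M 0 : I) : ℝ) = fold (F 0 - η / 2) := by
      change fold (F 0 + η * (fold (M * 0) - 1 / 2)) = _
      have : fold ((M : ℝ) * 0) = 0 := by simpa using fold_even (k := 0) (by simp)
      rw [this]; congr 1; ring
    have h1 : ((oscillate F hF η M 1 : I) : ℝ) = fold (F 1 - η / 2) := by
      change fold (F 1 + η * (fold (M * 1) - 1 / 2)) = _
      have : fold ((M : ℝ) * 1) = 0 := by simpa using fold_even hMeven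
      rw [this]; congr 1; ring
    have hne : ∀ (z : I) (r : ℝ), (z : ℝ) = fold (r - η / 2) →
        η ∉ range (fun k : ℤ => 2 * (r - k)) → z ∈ Ioo (0 : I) 1 := by
      intro z r hz hr
      have hfold : ¬ (fold (r - η / 2) = 0 ∨ fold (r - η / 2) = 1) := fun h => by
        obtain ⟨k, hk⟩ := exists_intCast_eq_of_fold h
        exact hr ⟨k, by simp only; linarith⟩
      rw [not_or, ← hz] at hfold
      exact ⟨bot_lt_iff_ne_bot.2 fun h => hfold.1 (congrArg Subtype.val h),
        lt_top_iff_ne_top.2 fun h => hfold.2 (congrArg Subtype.val h)⟩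
    exact movesEndpointsInside_of_mem_Ioo (hne _ _ h0 hgen.1) (hne _ _ h1 hgen.2)
  · rw [Subtype.dist_eq, Real.dist_eq]
    have hval : ((oscillate F hF η M x : I) : ℝ) =
      fold (F x + η * (fold (M * x) - 1 / 2)) := rfl
    have hosc : |η * (fold (M * x) - 1 / 2)| ≤ η / 2 := by
      have := fold_mem (M * x)
      rw [abs_mul, abs_of_pos hη0]
      have : |fold (M * (x : ℝ)) - 1 / 2| ≤ 1 / 2 :=
        abs_le.2 ⟨by linarith [this.1], by linarith [this.2]⟩
      nlinarith
    rw [hval, ← fold_of_mem (f x).2]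
    refine (abs_fold_sub_fold_le _ _).trans ?_
    have h1 := abs_le.1 (happrox x)
    have h2 := abs_le.1 hosc
    refine abs_le.2 ⟨?_, ?_⟩ <;> linarith [hη.2]

theorem dense_leo_CP : Dense {f : CP | IsLeo f.1 ∧ MovesEndpointsInside f.1} :=
  dense_leo_of_approx fun _ hf _ hε => by
    obtain ⟨g, hg, hd⟩ := exists_leo_near hf hε
    exact ⟨g, hg.1.mem_CP, hg, hd⟩

theorem leoOpenDenseWithSpecification {X : Set C(I, I)} (hX : X ⊆ CP)
    (hdense : Dense {f : X | IsLeo f.1 ∧ MovesEndpointsInside f.1}) :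
    LeoOpenDenseWithSpecification X :=
  ⟨isOpen_leo hX, hdense, fun _ _ hleo => hleo.periodicSpecification hleo.surjective⟩

end IntervalMaps

open IntervalMaps in
theorem theorem5p3 :
    IntervalMaps.LeoOpenDenseWithSpecification IntervalMaps.CP ∧
    IntervalMaps.LeoOpenDenseWithSpecification IntervalMaps.Clambda ∧
    ∀ μ : MeasureTheory.Measure unitInterval,
      MeasureTheory.IsProbabilityMeasure μ → (∀ x, μ {x} = 0) →
      MeasureTheory.Measure.IsOpenPosMeasure μ →
      IntervalMaps.LeoOpenDenseWithSpecification (IntervalMaps.Cmeas μ) := by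
  refine ⟨leoOpenDenseWithSpecification Set.Subset.rfl dense_leo_CP,
    leoOpenDenseWithSpecification (cmeas_subset_CP _) hasPerturbations_volume.dense, ?_⟩
  intro μ _ hna _
  obtain ⟨e, he⟩ := exists_orderIso_measurePreserving μ hna
  exact leoOpenDenseWithSpecification (cmeas_subset_CP μ)
    (hasPerturbations_volume.of_orderIso e he).dense
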